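/- Let $\Bbbk=\mathbb Z[q^{\pm 1/2}]$ and let $I=I_{uf}\sqcup I_f$ be a finite set of unfrozen and frozen vertices. A quantum seed $t$ consists of cluster variables $X_i$ ($i\in I$), an integer $I\times I_{uf}$-matrix $\widetilde B=(b_{ik})$ and a skew-symmetric integer $I\times I$-matrix $\Lambda$ forming a compatible pair, i.e. $\widetilde B^{T}\Lambda=(D\,|\,0)$ with $D=\mathrm{diag}(d_k)_{k\in I_{uf}}$, all $d_k>0$. Let $\mathcal{LP}(t)=\Bbbk[X_i^{\pm1}]_{i\in I}$, with its commutative product $\cdot$ (used to form the monomials $X^m$, $m\in\mathbb Z^I$) and its twisted product $X^m*X^n=q^{\Lambda(m,n)/2}X^{m+n}$. Let $Y^n=X^{\widetilde B n}$ for $n\in\mathbb Z^{I_{uf}}$, and let $\mathcal U(t)\subseteq \mathcal{LP}(t)$ be the upper cluster algebra, i.e. the intersection, in the skew-field of fractions of $\mathcal{LP}(t)$, of the rings $\mathcal{LP}(t'')$ over all seeds $t''$ obtained from $t$ by iterated quantum mutations. An element is $g$-pointed ($g\in\mathbb Z^I$) if it has the form $X^g\cdot(1+\sum_{0\ne n\in\mathbb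 N^{I_{uf}}}c_nY^n)$ (a finite sum, $c_n\in\Bbbk$); $g'\prec_t g$ means $g'=g+\widetilde B n$ for some $0\neq n\in\mathbb N^{I_{uf}}$; if $z$ is pointed and $w=q^\alpha z$ with $\alpha\in\frac12\mathbb Z$, put $[w]^t=z$. A seed $t[1]$ is a seed obtained from $t$ by iterated mutations such that, for some permutation $\sigma$ of $I_{uf}$ and every $k\in I_{uf}$, $X_{\sigma k}(t[1])$ is pointed in $\mathcal{LP}(t)$ of degree congruent to $-f_k$ modulo $\mathbb Z^{I_f}$, where $f_k$ is the $k$-th unit vector. A triangular basis of $\mathcal U(t)$ with respect to $t$ (which presupposes that a seed $t[1]$ exists) is a $\Bbbk$-basis $L^t=\{L^t_g\mid g\in\mathbb Z^I\}$ of $\mathcal U(t)$ such that: $L^t$ contains all cluster monomials of $t$ and of $t[1]$; each $L^t_g$ is $g$-pointed and is invariant under the bar involution $q^{\alpha}X^m\mapsto q^{-\alpha}X^m$; and for all $i\in I$ and $g\in\mathbb Z^I$, $[X_i*L^t_g]^t=L^t_{g+f_i}+\sum_{g'\prec_t g+f_i}b_{g'}L^t_{g'}$ (a finite sum) with all $b_{g'}\in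 q^{-1/2}\mathbb Z[q^{-1/2}]$. Let $\tilde t$ be another quantum seed, with vertex set $\tilde I=I_{uf}\sqcup\tilde I_f$ (the same unfrozen vertices, arbitrary finite set $\tilde I_f$ of frozen vertices), matrix entries $\tilde b_{ij}$ and multipliers $\tilde d_k$. Suppose that $\tilde t$ and $t$ are similar: there is a permutation $\tau$ of $I_{uf}$ with $b_{ij}=\tilde b_{\tau i,\tau j}$ and $d_k=\tilde d_{\tau k}$ for all $i,j,k\in I_{uf}$. Let $\tau$ act linearly on $\mathbb Z^{I_{uf}}$ by $\tau f_i=f_{\tau i}$, and regard $\mathbb Z^{I_{uf}}$ as a subset of $\mathbb Z^I$ and of $\mathbb Z^{\tilde I}$, extending vectors by zero on the frozen vertices. If $\mathcal U(t)$ has a triangular basis $L^t$ with respect to $t$, then $\mathcal U(\tilde t)$ has a triangular basis $L^{\tilde t}$ with respect to $\tilde t$ (in particular a seed $\tilde t[1]$ exists), such that for every $g\in\mathbb Z^{I_{uf}}$: if $$L^t_{g}=X^{g}\cdot\Bigl(1+\sum_{n>0}c_nY^n\Bigr)$$ in $\mathcal{LP}(t)$, then $$L^{\tilde t}_{\tau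 g}=X^{\tau g}\cdot\Bigl(1+\sum_{n>0}c_nY^{\tau n}\Bigr)$$ in $\mathcal{LP}(\tilde t)$. -/

import Mathlib

open scoped Matrix nonZeroDivisors

noncomputable section

namespace QuantumCluster

/-! ### The base ring and quantum tori -/

/-- The base ring `𝕜 = ℤ[q^{±1/2}]`: Laurent polynomials over `ℤ` in the variable `q^{1/2}`. -/
abbrev Base : Type := LaurentPolynomial ℤ

/-- `qHalf a` is `q^{a/2}`. -/
abbrev qHalf (a : ℤ) : Base := LaurentPolynomial.T a

/-- `𝔪 = q^{-1/2} ℤ[q^{-1/2}]`: only strictly negative powers of `q^{1/2}` occur. -/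
def maxIdeal : Set Base := {p | ∀ a : ℤ, p.coeff a ≠ 0 → a < 0}

section Torus

variable {I : Type*} [Fintype I]

/-- The bilinear form `Λ(m, n) = ∑ᵢⱼ mᵢ Λᵢⱼ nⱼ` on `ℤ^I`. -/
def form (Λ : Matrix I I ℤ) (m n : I → ℤ) : ℤ := m ⬝ᵥ (Λ *ᵥ n)

theorem form_add_left (Λ : Matrix I I ℤ) (m m' n : I → ℤ) :
    form Λ (m + m') n = form Λ m n + form Λ m' n := by
  simp [form, add_dotProduct]

theorem form_add_right (Λ : Matrix I I ℤ) (m n n' : I → ℤ) :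
    form Λ m (n + n') = form Λ m n + form Λ m n' := by
  simp [form, Matrix.mulVec_add, dotProduct_add]

theorem form_zero_left (Λ : Matrix I I ℤ) (n : I → ℤ) : form Λ 0 n = 0 := by simp [form]

theorem form_zero_right (Λ : Matrix I I ℤ) (m : I → ℤ) : form Λ m 0 = 0 := by simp [form]

/-- The underlying `𝕜`-module of the Laurent polynomial ring in variables indexed by `I`: an
element is the finitely supported family of its coefficients. The (twisted) multiplication given
below depends on `Λ`. -/
def QTorus (_Λ : Matrix I I ℤ) : Type _ := (I → ℤ) →₀ Base

namespace QTorus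

variable (Λ : Matrix I I ℤ)

instance : AddCommGroup (QTorus Λ) := inferInstanceAs (AddCommGroup ((I → ℤ) →₀ Base))
instance : Module Base (QTorus Λ) := inferInstanceAs (Module Base ((I → ℤ) →₀ Base))

/-- The `𝕜`-basis of Laurent monomials of `QTorus Λ`. -/
def monomialBasis : Module.Basis (I → ℤ) Base (QTorus Λ) :=
  ⟨(LinearEquiv.refl Base ((I → ℤ) →₀ Base) : QTorus Λ ≃ₗ[Base] ((I → ℤ) →₀ Base))⟩

/-- The Laurent monomial `X^m` (for the commutative product). -/
def X (m : I → ℤ) : QTorus Λ := monomialBasis Λ m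

/-- The twisted product `*` as a `𝕜`-bilinear map: `X^m * X^n = q^{Λ(m,n)/2} X^{m+n}`. -/
def mulMap : QTorus Λ →ₗ[Base] QTorus Λ →ₗ[Base] QTorus Λ :=
  (monomialBasis Λ).constr Base fun m : I → ℤ =>
    (monomialBasis Λ).constr Base fun n : I → ℤ => qHalf (form Λ m n) • X Λ (m + n)

instance : Mul (QTorus Λ) := ⟨fun z w => mulMap Λ z w⟩
instance : One (QTorus Λ) := ⟨X Λ 0⟩

variable {Λ}

theorem mul_def (z w : QTorus Λ) : z * w = mulMap Λ z w := rfl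

theorem one_def : (1 : QTorus Λ) = X Λ 0 := rfl

theorem X_mul_X (m n : I → ℤ) : X Λ m * X Λ n = qHalf (form Λ m n) • X Λ (m + n) := by
  rw [mul_def, mulMap]
  nth_rw 1 [X]
  nth_rw 1 [X]
  rw [Module.Basis.constr_basis, Module.Basis.constr_basis]

/-- Induction principle: the monomials span. -/
theorem induction {p : QTorus Λ → Prop} (z : QTorus Λ) (h0 : p 0)
    (hadd : ∀ z w, p z → p w → p (z + w)) (hX : ∀ (a : Base) m, p (a • X Λ m)) : p z := by
  rw [← (monomialBasis Λ).linearCombination_repr z, Finsupp.linearCombination_apply]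
  exact Finset.sum_induction _ p hadd h0 fun m _ => hX _ m

protected theorem add_mul (x y z : QTorus Λ) : (x + y) * z = x * z + y * z := by
  simp [mul_def]

protected theorem mul_add (x y z : QTorus Λ) : x * (y + z) = x * y + x * z := by
  simp [mul_def]

protected theorem smul_mul (a : Base) (x y : QTorus Λ) : (a • x) * y = a • (x * y) := by
  simp [mul_def]

protected theorem mul_smul (a : Base) (x y : QTorus Λ) : x * (a • y) = a • (x * y) := by
  simp [mul_def]

instance : Ring (QTorus Λ) where
  left_distrib := QTorus.mul_add
  right_distrib := QTorus.add_mul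
  zero_mul x := by simp [mul_def]
  mul_zero x := by simp [mul_def]
  mul_assoc x y z := by
    induction x using QTorus.induction with
    | h0 => simp [mul_def]
    | hadd u v hu hv => simp only [QTorus.add_mul, hu, hv]
    | hX a l =>
    induction y using QTorus.induction with
    | h0 => simp [mul_def]
    | hadd u v hu hv => simp only [QTorus.add_mul, QTorus.mul_add, hu, hv]
    | hX b m =>
    induction z using QTorus.induction with
    | h0 => simp [mul_def]
    | hadd u v hu hv => simp only [QTorus.mul_add, hu, hv]
    | hX c n =>
    simp only [QTorus.smul_mul, QTorus.mul_smul, X_mul_X, smul_smul, qHalf, form_add_left,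
      form_add_right, LaurentPolynomial.T_add, add_assoc]
    congr 1
    ring
  one_mul x := by
    induction x using QTorus.induction with
    | h0 => simp [mul_def]
    | hadd u v hu hv => simp only [QTorus.mul_add, hu, hv]
    | hX a l => simp [QTorus.mul_smul, one_def, X_mul_X, form_zero_left]
  mul_one x := by
    induction x using QTorus.induction with
    | h0 => simp [mul_def]
    | hadd u v hu hv => simp only [QTorus.add_mul, hu, hv]
    | hX a l => simp [QTorus.smul_mul, one_def, X_mul_X, form_zero_right]
  neg_add_cancel := neg_add_cancel
  zsmul := fun n x => n • x
  zsmul_zero' := SubNegMonoid.zsmul_zero'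
  zsmul_succ' := SubNegMonoid.zsmul_succ'
  zsmul_neg' := SubNegMonoid.zsmul_neg'
  nsmul := fun n x => n • x
  nsmul_zero := AddMonoid.nsmul_zero
  nsmul_succ := AddMonoid.nsmul_succ
  sub_eq_add_neg := sub_eq_add_neg

instance : Algebra Base (QTorus Λ) := Algebra.ofModule QTorus.smul_mul QTorus.mul_smul

/-- The coefficient of `X^m` in `z`. -/
def coeff (m : I → ℤ) : QTorus Λ →ₗ[Base] Base := (monomialBasis Λ).coord m

theorem coeff_X [DecidableEq I] (m n : I → ℤ) :
    coeff n (X Λ m) = if m = n then 1 else 0 := by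
  simp [coeff, X, Finsupp.single_apply]

theorem coeff_ext {z w : QTorus Λ} (h : ∀ m, coeff m z = coeff m w) : z = w :=
  (monomialBasis Λ).repr.injective (Finsupp.ext h)

theorem sum_coeff (z : QTorus Λ) :
    z = ∑ m ∈ ((monomialBasis Λ).repr z).support, coeff m z • X Λ m := by
  conv_lhs => rw [← (monomialBasis Λ).linearCombination_repr z, Finsupp.linearCombination_apply]
  rfl

theorem mul_eq_sum (z w : QTorus Λ) :
    z * w = ∑ m ∈ ((monomialBasis Λ).repr z).support, ∑ n ∈ ((monomialBasis Λ).repr w).support,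
      (coeff m z * coeff n w * qHalf (form Λ m n)) • X Λ (m + n) := by
  conv_lhs => rw [sum_coeff z, sum_coeff w, Finset.sum_mul]
  refine Finset.sum_congr rfl fun m _ => ?_
  rw [Finset.mul_sum]
  refine Finset.sum_congr rfl fun n _ => ?_
  rw [QTorus.smul_mul, QTorus.mul_smul, X_mul_X, smul_smul, smul_smul]

theorem support_nonempty {z : QTorus Λ} (hz : z ≠ 0) :
    ((monomialBasis Λ).repr z).support.Nonempty := by
  simpa using hz

theorem one_ne_zero' : (1 : QTorus Λ) ≠ 0 := (monomialBasis Λ).ne_zero 0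

instance : Nontrivial (QTorus Λ) := ⟨1, 0, one_ne_zero'⟩

theorem mul_ne_zero' {z w : QTorus Λ} (hz : z ≠ 0) (hw : w ≠ 0) : z * w ≠ 0 := by
  classical
  obtain ⟨a, ha, b, hb, h⟩ :=
    UniqueSums.uniqueAdd_of_nonempty (support_nonempty hz) (support_nonempty hw)
  intro h0
  have key : coeff (a + b) (z * w) = coeff a z * coeff b w * qHalf (form Λ a b) := by
    rw [mul_eq_sum, map_sum, Finset.sum_eq_single a, map_sum, Finset.sum_eq_single b]
    · simp [coeff_X]
    · intro n hn hne
      rw [map_smul, coeff_X, if_neg, smul_zero]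
      exact fun e => hne (h ha hn e).2
    · exact fun hb' => absurd hb hb'
    · intro m hm hne
      rw [map_sum]
      refine Finset.sum_eq_zero fun n hn => ?_
      rw [map_smul, coeff_X, if_neg, smul_zero]
      exact fun e => hne (h hm hn e).1
    · exact fun ha' => absurd ha ha'
  rw [h0, map_zero] at key
  refine mul_ne_zero (mul_ne_zero (Finsupp.mem_support_iff.1 ha) (Finsupp.mem_support_iff.1 hb))
    (LaurentPolynomial.isUnit_T _).ne_zero key.symm

instance : NoZeroDivisors (QTorus Λ) where
  eq_zero_or_eq_zero_of_mul_eq_zero {z w} h := by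
    by_contra! h'
    exact mul_ne_zero' h'.1 h'.2 h

/-- The box `[-N, N]^I` in `ℤ^I`. -/
def box [DecidableEq I] (N : ℕ) : Finset (I → ℤ) :=
  Fintype.piFinset fun _ => Finset.Icc (-(N : ℤ)) N

theorem card_box [DecidableEq I] (N : ℕ) :
    (box (I := I) N).card = (2 * N + 1) ^ Fintype.card I := by
  have : ((N : ℤ) + 1 + N).toNat = 2 * N + 1 := by omega
  simp [box, this]

theorem exists_box [DecidableEq I] (s : Finset (I → ℤ)) : ∃ c : ℕ, s ⊆ box c := by
  refine ⟨s.sup fun m => Finset.univ.sup fun i => (m i).natAbs, fun m hm => ?_⟩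
  simp only [box, Fintype.mem_piFinset, Finset.mem_Icc]
  intro i
  have h1 : (m i).natAbs ≤ Finset.univ.sup fun i => (m i).natAbs :=
    Finset.le_sup (f := fun i => (m i).natAbs) (Finset.mem_univ i)
  have h2 := Finset.le_sup (f := fun m : I → ℤ => Finset.univ.sup fun i => (m i).natAbs) hm
  have h3 := h1.trans h2
  omega

theorem add_mem_box [DecidableEq I] {N c : ℕ} {m n : I → ℤ} (hm : m ∈ box N) (hn : n ∈ box c) :
    m + n ∈ box (N + c) := by
  simp only [box, Fintype.mem_piFinset, Finset.mem_Icc, Pi.add_apply] at *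
  intro i
  have := hm i
  have := hn i
  push_cast
  omega

theorem exists_pow_lt (d c : ℕ) : ∃ N : ℕ, (2 * (N + c) + 1) ^ d < 2 * (2 * N + 1) ^ d := by
  refine ⟨2 * c * d + 1, ?_⟩
  set N := 2 * c * d + 1
  have hy : (0 : ℝ) < 2 * (N + c) + 1 := by positivity
  have h := one_add_mul_le_pow (a := -(2 * c / (2 * (N + c) + 1) : ℝ)) (by
    rw [neg_le_neg_iff, div_le_iff₀ hy]; linarith [(Nat.cast_nonneg N : (0 : ℝ) ≤ N)]) d
  have h1 : (1 : ℝ) / 2 < 1 + d * -(2 * c / (2 * (N + c) + 1) : ℝ) := by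
    have : (d * (2 * c / (2 * (N + c) + 1)) : ℝ) < 1 / 2 := by
      rw [← mul_div_assoc, div_lt_iff₀ hy]
      have : (N : ℝ) = 2 * c * d + 1 := by simp [N]
      rw [this]
      have : (0 : ℝ) ≤ c := Nat.cast_nonneg c
      nlinarith
    linarith
  have h2 : 1 + -(2 * c / (2 * (N + c) + 1) : ℝ) = (2 * N + 1) / (2 * (N + c) + 1) := by
    field_simp; ring
  rw [h2, div_pow] at h
  have h3 := h1.trans_le h
  rw [div_lt_div_iff₀ two_pos (by positivity)] at h3
  have : ((2 * (N + c) + 1 : ℝ)) ^ d < 2 * (2 * N + 1) ^ d := by linarith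
  exact_mod_cast this

theorem X_mul_mem [DecidableEq I] [DecidableEq (QTorus Λ)] {N c : ℕ} {m : I → ℤ} (hm : m ∈ box N) {r : QTorus Λ}
    (hr : ((monomialBasis Λ).repr r).support ⊆ box c) :
    X Λ m * r ∈ Submodule.span Base
      (((box (N + c)).image (X Λ) : Finset (QTorus Λ)) : Set (QTorus Λ)) := by
  rw [sum_coeff r, Finset.mul_sum]
  refine Submodule.sum_mem _ fun n hn => ?_
  rw [QTorus.mul_smul, X_mul_X, smul_smul]
  refine Submodule.smul_mem _ _ (Submodule.subset_span ?_)
  exact Finset.mem_coe.2 (Finset.mem_image_of_mem _ (add_mem_box hm (hr hn)))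

theorem exists_ore (r s : QTorus Λ) (hs : s ≠ 0) :
    ∃ r' s' : QTorus Λ, s' ≠ 0 ∧ s' * r = r' * s := by
  classical
  by_contra! H
  replace H : ∀ r' s' : QTorus Λ, s' * r + r' * s = 0 → s' = 0 ∧ r' = 0 := by
    intro r' s' h
    have h1 : s' = 0 := by
      by_contra hne
      exact H (-r') s' hne (by rw [neg_mul]; exact eq_neg_of_add_eq_zero_left h)
    refine ⟨h1, ?_⟩
    rw [h1, zero_mul, zero_add] at h
    exact (mul_eq_zero.1 h).resolve_right hs
  obtain ⟨c, hc⟩ := exists_box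
    (((monomialBasis Λ).repr r).support ∪ ((monomialBasis Λ).repr s).support)
  obtain ⟨N, hN⟩ := exists_pow_lt (Fintype.card I) c
  let v : box (I := I) N ⊕ box (I := I) N → QTorus Λ :=
    Sum.elim (fun m => X Λ m * r) (fun m => X Λ m * s)
  have hind : LinearIndependent Base fun m : box (I := I) N => X Λ (m : I → ℤ) :=
    (monomialBasis Λ).linearIndependent.comp _ Subtype.val_injective
  have hv : LinearIndependent Base v := by
    rw [Fintype.linearIndependent_iff] at hind ⊢
    intro g hg
    rw [Fintype.sum_sum_type] at hg
    have := H (∑ m : box (I := I) N, g (Sum.inr m) • X Λ (m : I → ℤ))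
      (∑ m : box (I := I) N, g (Sum.inl m) • X Λ (m : I → ℤ)) (by
        rw [Finset.sum_mul, Finset.sum_mul]
        simpa only [QTorus.smul_mul, v, Sum.elim_inl, Sum.elim_inr] using hg)
    rintro (i | i)
    · exact hind _ this.1 i
    · exact hind _ this.2 i
  have hle := linearIndependent_le_span' v hv
    (((box (N + c)).image (X Λ) : Finset (QTorus Λ)) : Set (QTorus Λ)) (by
      rintro _ ⟨i | i, rfl⟩
      · exact X_mul_mem i.2 (Finset.union_subset_left hc)
      · exact X_mul_mem i.2 (Finset.union_subset_right hc))
  have hcard : ((box (I := I) (N + c)).image (X Λ)).card ≤ (2 * (N + c) + 1) ^ Fintype.card I :=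
    Finset.card_image_le.trans (card_box _).le
  rw [Cardinal.mk_fintype] at hle
  simp only [Fintype.card_sum, Fintype.card_coe, card_box, Finset.coe_sort_coe] at hle
  have hle' := Nat.cast_le.1 hle
  omega

/-- A quantum torus is an Ore domain. -/
instance : OreLocalization.OreSet (nonZeroDivisors (QTorus Λ)) :=
  OreLocalization.oreSetOfNoZeroDivisors
    (fun r s => (exists_ore r s (nonZeroDivisors.ne_zero s.2)).choose)
    (fun r s => ⟨(exists_ore r s (nonZeroDivisors.ne_zero s.2)).choose_spec.choose,
      mem_nonZeroDivisors_of_ne_zero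
        (exists_ore r s (nonZeroDivisors.ne_zero s.2)).choose_spec.choose_spec.1⟩)
    (fun r s => (exists_ore r s (nonZeroDivisors.ne_zero s.2)).choose_spec.choose_spec.2)

/-- The bar involution: it is additive and sends `q^{α} X^m` to `q^{-α} X^m`. -/
def bar (z : QTorus Λ) : QTorus Λ :=
  (monomialBasis Λ).repr.symm
    (((monomialBasis Λ).repr z).mapRange (LaurentPolynomial.invert (R := ℤ)) (map_zero _))

end QTorus

end Torus

/-! ### Quantum seeds, mutations, upper cluster algebras -/

/-- The combinatorial data of a quantum seed with unfrozen vertices `U` and frozen vertices `F`: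
a compatible pair `(B, Λ)` in the sense of Berenstein and Zelevinsky. The columns of `B` are
indexed by `U`; compatibility reads `Bᵀ Λ = (D | 0)` with `D` diagonal with positive entries `d`.
(The cluster variables of the seed are the generators `X_i` of the quantum torus below.) -/
structure QuantumSeed (U F : Type*) [Fintype U] [Fintype F] [DecidableEq U] where
  B : Matrix (U ⊕ F) U ℤ
  Λ : Matrix (U ⊕ F) (U ⊕ F) ℤ
  d : U → ℤ
  skew : Λᵀ = -Λ
  d_pos : ∀ k, 0 < d k
  compatible : Bᵀ * Λ = Matrix.fromCols (Matrix.diagonal d) 0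

section Seeds

variable {U F : Type*} [Fintype U] [Fintype F] [DecidableEq U] [DecidableEq F]

/-- The Laurent polynomial ring `LP(t)` with the twisted product. -/
abbrev LP (t : QuantumSeed U F) : Type _ := QTorus t.Λ

/-- The skew-field of fractions of `LP(t)`. -/
abbrev Frac (t : QuantumSeed U F) : Type _ :=
  OreLocalization (nonZeroDivisors (LP t)) (LP t)

/-- The inclusion of `LP(t)` into its skew-field of fractions. -/
abbrev incl (t : QuantumSeed U F) : LP t →+* Frac t := OreLocalization.numeratorRingHom

/-- Unit vectors `f_i` of `ℤ^I`, where `I = U ⊔ F`. -/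
abbrev f (i : U ⊕ F) : U ⊕ F → ℤ := Pi.single i 1

/-- A seed inside the ambient skew-field `Frac t`. It is given by its Laurent monomials
`X m` for `m ∈ ℤ^I` (taken for the commutative product of that seed; the cluster variables are
`X (f i)`) and by its matrices `B` and `Λ`. -/
structure SeedIn (t : QuantumSeed U F) where
  X : (U ⊕ F → ℤ) → Frac t
  B : Matrix (U ⊕ F) U ℤ
  Λ : Matrix (U ⊕ F) (U ⊕ F) ℤ

namespace SeedIn

variable {t : QuantumSeed U F}

/-- The seed `t` itself. -/
def initial (t : QuantumSeed U F) : SeedIn t where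
  X m := incl t (QTorus.X t.Λ m)
  B := t.B
  Λ := t.Λ

/-- The mutated variable
`X_k' = X^{-f_k + ∑ᵢ [b_{ik}]₊ f_i} + X^{-f_k + ∑ᵢ [-b_{ik}]₊ f_i}`. -/
def mutVar (s : SeedIn t) (k : U) : Frac t :=
  s.X (-f (Sum.inl k) + fun i => max (s.B i k) 0) +
    s.X (-f (Sum.inl k) + fun i => max (-s.B i k) 0)

/-- The mutated matrix `B'`. -/
def mutB (s : SeedIn t) (k : U) : Matrix (U ⊕ F) U ℤ := fun i j =>
  if i = Sum.inl k ∨ j = k then -s.B i j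
  else s.B i j + (max (s.B i k) 0 * max (s.B (Sum.inl k) j) 0
    - max (-s.B i k) 0 * max (-s.B (Sum.inl k) j) 0)

/-- The mutated matrix `Λ' = Eᵀ Λ E`: the matrix of the form `Λ` on the vectors `f_i` for `i ≠ k`
and `-f_k + ∑ᵢ [-b_{ik}]₊ f_i`. -/
def mutΛ (s : SeedIn t) (k : U) : Matrix (U ⊕ F) (U ⊕ F) ℤ :=
  let e : U ⊕ F → (U ⊕ F → ℤ) := fun i =>
    if i = Sum.inl k then -f (Sum.inl k) + fun j => max (-s.B j k) 0 else f i
  fun i j => form s.Λ (e i) (e j)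

/-- The mutation `μ_k`. Its Laurent monomials are those in `X_k'` and the `X_i` with `i ≠ k`: with
`b = m_k f_k` and `a = m - b`, the relation `X'^a * X'^b = q^{Λ'(a,b)/2} X'^m` gives
`X'^m = q^{-Λ'(a,b)/2} X^a * (X_k')^{m_k}`. -/
def mutate (s : SeedIn t) (k : U) : SeedIn t where
  X m :=
    let b : U ⊕ F → ℤ := Pi.single (Sum.inl k) (m (Sum.inl k))
    qHalf (-form (s.mutΛ k) (m - b) b) • (s.X (m - b) * s.mutVar k ^ m (Sum.inl k))
  B := s.mutB k
  Λ := s.mutΛ k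

/-- The Laurent polynomial ring `LP(s) ⊆ Frac t` of the seed `s`. -/
def laurent (s : SeedIn t) : Submodule Base (Frac t) := Submodule.span Base (Set.range s.X)

end SeedIn

/-- `Reachable t s`: `s ∈ Δ⁺`, that is, `s` is obtained from `t` by iterated mutations. -/
inductive Reachable (t : QuantumSeed U F) : SeedIn t → Prop
  | initial : Reachable t (SeedIn.initial t)
  | mutate (s : SeedIn t) (k : U) : Reachable t s → Reachable t (s.mutate k)

/-- The upper cluster algebra `𝒰(t) = ⋂_{s ∈ Δ⁺} LP(s)`, viewed inside `LP(t)`. -/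
def upperClusterAlgebra (t : QuantumSeed U F) : Submodule Base (LP t) where
  carrier := {z | ∀ s, Reachable t s → incl t z ∈ s.laurent}
  add_mem' hz hw s hs := by
    rw [map_add]
    exact add_mem (hz s hs) (hw s hs)
  zero_mem' s _ := by
    rw [map_zero]
    exact zero_mem _
  smul_mem' a z hz s hs := by
    have h : incl t (a • z) = a • incl t z := OreLocalization.smul_oreDiv_one a z |>.symm
    rw [h]
    exact Submodule.smul_mem _ a (hz s hs)

/-! ### Pointed elements and triangular bases -/

/-- `X^g · ∑ₙ cₙ Yⁿ = ∑ₙ cₙ X^{g + B n}` (commutative product), for a finitely supported family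
`c` indexed by `ℕ^U`; here `Yⁿ = X^{B n}`. -/
def fSeries (t : QuantumSeed U F) (g : U ⊕ F → ℤ) (c : (U → ℕ) →₀ Base) : LP t :=
  c.sum fun n a => a • QTorus.X t.Λ (g + t.B *ᵥ fun k => (n k : ℤ))

/-- `z` is `g`-pointed: `z = X^g · (1 + ∑_{n > 0} cₙ Yⁿ)`. -/
def IsPointed (t : QuantumSeed U F) (g : U ⊕ F → ℤ) (z : LP t) : Prop :=
  ∃ c : (U → ℕ) →₀ Base, c 0 = 1 ∧ z = fSeries t g c

/-- The dominance order `g' ≺_t g`. -/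
def Dominated (t : QuantumSeed U F) (g' g : U ⊕ F → ℤ) : Prop :=
  ∃ n : U → ℕ, n ≠ 0 ∧ g' = g + t.B *ᵥ fun k => (n k : ℤ)

/-- `z = [w]^t`: `z` is pointed and `w = q^α z` for some `α ∈ ½ℤ`. -/
def IsNormalization (t : QuantumSeed U F) (w z : LP t) : Prop :=
  (∃ g, IsPointed t g z) ∧ ∃ α : ℤ, w = qHalf α • z

/-- `s` is a seed `t[1]`: it is reachable from `t` and, for some permutation `σ` of the unfrozen
vertices, `X_{σ k}(s)` is pointed in `LP(t)` of degree `-f_k` modulo the frozen directions. -/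
def IsShift (t : QuantumSeed U F) (s : SeedIn t) : Prop :=
  Reachable t s ∧ ∃ σ : Equiv.Perm U, ∀ k, ∃ (z : LP t) (g : U ⊕ F → ℤ),
    incl t z = s.X (f (Sum.inl (σ k))) ∧ IsPointed t g z ∧
      ∀ i : U, g (Sum.inl i) = -(Pi.single k 1 : U → ℤ) i

/-- The family `L = (L_g)_{g ∈ ℤ^I}` is a triangular basis of `𝒰(t)` with respect to `t`. The
existence of a seed `t[1]` (injective-reachability of `t`) is part of the notion. -/
structure IsTriangularBasis (t : QuantumSeed U F) (L : (U ⊕ F → ℤ) → LP t) : Prop where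
  linearIndependent : LinearIndependent Base L
  span_eq : Submodule.span Base (Set.range L) = upperClusterAlgebra t
  /-- `L` contains the cluster monomials of `t`. -/
  monomial_mem : ∀ m : U ⊕ F → ℕ, QTorus.X t.Λ (fun i => (m i : ℤ)) ∈ Set.range L
  /-- `L` contains the cluster monomials of `t[1]`. -/
  shift_monomial_mem : ∃ s : SeedIn t, IsShift t s ∧
    ∀ m : U ⊕ F → ℕ, ∃ g, incl t (L g) = s.X fun i => (m i : ℤ)
  pointed : ∀ g, IsPointed t g (L g)
  bar_eq : ∀ g, (L g).bar = L g
  /-- `[X_i * L_g]^t = L_{g + f_i} + ∑_{g' ≺ g + f_i} b_{g'} L_{g'}` with `b_{g'} ∈ 𝔪`. -/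
  triangular : ∀ (i : U ⊕ F) (g : U ⊕ F → ℤ), ∃ b : (U ⊕ F → ℤ) →₀ Base,
    (∀ g' ∈ b.support, Dominated t g' (g + f i) ∧ b g' ∈ maxIdeal) ∧
    IsNormalization t (QTorus.X t.Λ (f i) * L g) (L (g + f i) + b.sum fun g' a => a • L g')

/-- The seeds `t` and `t'`, with the same unfrozen vertices, are similar through the permutation
`τ`: their principal parts and their multipliers `d` (which govern the quantization of the
principal parts) agree up to `τ`. -/
def Similar {F' : Type*} [Fintype F'] (τ : Equiv.Perm U) (t : QuantumSeed U F)
    (t' : QuantumSeed U F') : Prop :=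
  (∀ i j : U, t.B (Sum.inl i) j = t'.B (Sum.inl (τ i)) (τ j)) ∧ ∀ k : U, t.d k = t'.d (τ k)

/-- The linear action of a permutation `τ` on vectors: `τ f_i = f_{τ i}`. -/
def permute {A : Type*} (τ : Equiv.Perm U) (v : U → A) : U → A := fun i => v (τ.symm i)

/-- The inclusion `ℤ^U ⊆ ℤ^I` (zero on the frozen vertices). -/
def extend {F : Type*} (g : U → ℤ) : U ⊕ F → ℤ := Sum.elim g 0

end Seeds

end QuantumCluster

end

/-!
The principal part `b` and the multipliers `d` of a seed `t` determine `LP(t)` and `𝒰(t)` up to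
frozen variables, in the following sense. Compatibility gives `Λ(B n, g) = ∑ₖ d_k n_k g_k`, so the
monomials `Yⁿ` span a quantum torus which depends only on `b` and `d` (`yForm`), and commuting a
`Yⁿ` past `X^g` only involves the unfrozen part of `g`. The ring `LP(t)` is graded by
`ℤ^I / B ℤ^U`, and the homogeneous elements of the degree of `X^g` are the products `r * X^g` with
`r` in this torus (`HasPrincipalPart.ser_eq_mul`).

The Laurent monomials of every seed reachable from `t` have the form `R * X^g`, with `R` in the
skew-field of fractions of the torus of the `Yⁿ`. A mutation acts on them by the linear map
`mutVec` on exponents and multiplication by a quotient of quantum dilogarithms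
(`SeedIn.IsCompatible.mutate_X`), because the integer powers of a mutated variable are powers of a
quantum binomial (`IsFrame.binomial_zpow`). Hence `R` and the unfrozen part of `g` follow a
recursion in terms of `b` and `d` alone, the pattern of `PatternSeed`, which describes
simultaneously all seeds with this principal part (`PatternSeed.Describes`).

A Laurent expansion in a reachable seed can be decomposed into homogeneous components
(`HasPrincipalPart.toFrac_homPart`). So the homogeneous element `X^g · ∑ₙ cₙ Yⁿ` lies in `𝒰(t)` if
and only if a condition holds that mentions only `c`, the unfrozen part of `g`, and the pattern
(`HasPrincipalPart.ser_mem_upperClusterAlgebra_iff`); the same condition governs `𝒰(t')`.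

In a triangular basis, the product of `L_g` with a frozen variable is bar-invariant up to a power
of `q`, so the triangularity relation for it has no correction terms
(`IsTriangularBasis.add_frozen`). Therefore the coefficients of `L_g` depend only on the unfrozen
part of `g`, and the same coefficients define a family in `LP(t')` (`pointedFamily`). Every
defining property of a triangular basis is a statement about homogeneous elements, which carries
over from `t` to `t'`.
-/

set_option linter.unusedSectionVars false

noncomputable section

namespace QuantumCluster

/-! ### Powers of quantum binomials -/

section Dilog

variable {D E : Type*} [DivisionRing D] [Algebra Base D] [DivisionRing E] [Algebra Base E]

/-- The product `∏_{0 ≤ j < n} (1 + q^{(2j+1)d/2} y)`. -/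
def qprod (d : ℤ) (y : D) : ℕ → D
  | 0 => 1
  | n + 1 => qprod d y n * (1 + qHalf ((2 * n + 1) * d) • y)

/-- The quotient of quantum dilogarithms which, for every integer `n`, expresses the `n`-th power
of a quantum binomial: `∏_{0 ≤ j < n} (1 + q^{(2j+1)d/2} y)` for `n ≥ 0`, and the inverse of
`∏_{n ≤ j < 0} (1 + q^{(2j+1)d/2} y)` for `n < 0`. -/
def qdilog (d : ℤ) (y : D) : ℤ → D
  | Int.ofNat n => qprod d y n
  | Int.negSucc n => (qprod (-d) y (n + 1))⁻¹

theorem qprod_succ (d : ℤ) (y : D) (n : ℕ) :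
    qprod d y (n + 1) = qprod d y n * (1 + qHalf ((2 * n + 1) * d) • y) := rfl

theorem qdilog_zero (d : ℤ) (y : D) : qdilog d y 0 = 1 := rfl

theorem map_qprod (φ : D →ₐ[Base] E) (d : ℤ) (y : D) (n : ℕ) :
    φ (qprod d y n) = qprod d (φ y) n := by
  induction n with
  | zero => simp [qprod]
  | succ n ih => simp [qprod, ih]

theorem map_qdilog (φ : D →ₐ[Base] E) (d : ℤ) (y : D) (n : ℤ) :
    φ (qdilog d y n) = qdilog d (φ y) n := by
  cases n with
  | ofNat n => exact map_qprod φ d y n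
  | negSucc n => simp only [qdilog, map_inv₀, map_qprod]

theorem commute_qprod {z y : D} (h : Commute z y) (d : ℤ) (n : ℕ) : Commute z (qprod d y n) := by
  induction n with
  | zero => exact Commute.one_right z
  | succ n ih => exact ih.mul_right ((Commute.one_right z).add_right (h.smul_right _))

theorem commute_qdilog {z y : D} (h : Commute z y) (d : ℤ) (n : ℤ) :
    Commute z (qdilog d y n) := by
  cases n with
  | ofNat n => exact commute_qprod h d n
  | negSucc n => exact (commute_qprod h (-d) (n + 1)).inv_right₀

theorem qdilog_add_one {y : D} (hy : ∀ a : ℤ, 1 + qHalf a • y ≠ 0) (d n : ℤ) :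
    qdilog d y (n + 1) = qdilog d y n * (1 + qHalf ((2 * n + 1) * d) • y) := by
  cases n with
  | ofNat n => exact qprod_succ d y n
  | negSucc n =>
    have e : (2 * (n : ℤ) + 1) * -d = (2 * Int.negSucc n + 1) * d := by
      rw [Int.negSucc_eq]; ring
    have h1 : qdilog d y (Int.negSucc n + 1) = (qprod (-d) y n)⁻¹ := by
      cases n with
      | zero => simp [qdilog_zero, qprod]
      | succ n => rfl
    have hc : Commute (1 + qHalf ((2 * n + 1) * -d) • y) (qprod (-d) y n) :=
      commute_qprod ((Commute.one_left y).add_left ((Commute.refl y).smul_left _)) _ _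
    rw [h1, qdilog, qprod_succ, mul_inv_rev, ← e, mul_assoc, ← hc.inv_right₀.eq, ← mul_assoc,
      inv_mul_cancel₀ (hy _), one_mul]

theorem eq_zpow_of_recurrence {V : D} (hV : V ≠ 0) {W : ℤ → D} (h0 : W 0 = 1)
    (h1 : ∀ n, W (n + 1) = W n * V) (n : ℤ) : W n = V ^ n := by
  induction n using Int.induction_on with
  | zero => rw [h0, zpow_zero]
  | succ n ih => rw [h1, ih, zpow_add_one₀ hV]
  | pred n ih =>
    have := h1 (-(n : ℤ) - 1)
    rw [sub_add_cancel, ih] at this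
    rw [zpow_sub_one₀ hV, this, mul_assoc, mul_inv_cancel₀ hV, mul_one]

end Dilog

/-! ### Normalized monomials in a skew field -/

section Frame

variable {D : Type*} [DivisionRing D] [Algebra Base D]
variable {I : Type*} [Fintype I]

theorem form_smul_left (Λ : Matrix I I ℤ) (a : ℤ) (m n : I → ℤ) :
    form Λ (a • m) n = a * form Λ m n := by
  rw [form, smul_dotProduct, smul_eq_mul, form]

theorem form_smul_right (Λ : Matrix I I ℤ) (a : ℤ) (m n : I → ℤ) :
    form Λ m (a • n) = a * form Λ m n := by
  rw [form, Matrix.mulVec_smul, dotProduct_smul, smul_eq_mul, form]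

theorem form_neg_left (Λ : Matrix I I ℤ) (m n : I → ℤ) : form Λ (-m) n = -form Λ m n := by
  simp [form]

theorem form_neg_right (Λ : Matrix I I ℤ) (m n : I → ℤ) : form Λ m (-n) = -form Λ m n := by
  simp [form, Matrix.mulVec_neg]

theorem qHalf_smul_inj {M : Type*} [AddCommGroup M] [Module Base M] {a : ℤ} {x y : M} :
    qHalf a • x = qHalf a • y ↔ x = y :=
  (LaurentPolynomial.isUnit_T a).smul_left_cancel

theorem qHalf_smul_smul {M : Type*} [AddCommGroup M] [Module Base M] (a b : ℤ) (x : M) :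
    qHalf a • qHalf b • x = qHalf (a + b) • x := by
  simp only [smul_smul, qHalf, LaurentPolynomial.T_add]

theorem qHalf_zero_smul {M : Type*} [AddCommGroup M] [Module Base M] (x : M) :
    qHalf 0 • x = x := by
  simp only [qHalf, LaurentPolynomial.T_zero, one_smul]

theorem qHalf_injective : Function.Injective qHalf := by
  intro a b h
  have h1 : (LaurentPolynomial.T a : Base).coeff a = (LaurentPolynomial.T b : Base).coeff a :=
    congrArg (fun p : Base => p.coeff a) h
  by_contra hne
  rw [LaurentPolynomial.T, LaurentPolynomial.T, AddMonoidAlgebra.coeff_single,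
    AddMonoidAlgebra.coeff_single, Finsupp.single_eq_same, Finsupp.single_eq_of_ne hne] at h1
  exact one_ne_zero h1

/-- A family `X` of elements of a skew field is a quantum torus frame for `Λ` if it obeys the
multiplication rule of normalized Laurent monomials. -/
structure IsFrame (Λ : Matrix I I ℤ) (X : (I → ℤ) → D) : Prop where
  zero : X 0 = 1
  mul : ∀ m n, X m * X n = qHalf (form Λ m n) • X (m + n)
  skew : ∀ m n, form Λ m n = -form Λ n m

namespace IsFrame

variable {Λ : Matrix I I ℤ} {X : (I → ℤ) → D} (hX : IsFrame Λ X)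
include hX

theorem self (m : I → ℤ) : form Λ m m = 0 := by
  have := hX.skew m m
  omega

theorem ne_zero (m : I → ℤ) : X m ≠ 0 := by
  intro h
  have h1 := hX.mul m (-m)
  rw [h, zero_mul, add_neg_cancel, hX.zero, form_neg_right, hX.self, neg_zero,
    qHalf_zero_smul] at h1
  exact zero_ne_one h1

theorem add_eq (m n : I → ℤ) : X (m + n) = qHalf (-form Λ m n) • (X m * X n) := by
  rw [hX.mul, qHalf_smul_smul, neg_add_cancel, qHalf_zero_smul]

theorem mul_comm_smul (m n : I → ℤ) : X m * X n = qHalf (2 * form Λ m n) • (X n * X m) := by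
  rw [hX.mul, hX.mul, qHalf_smul_smul, add_comm n m, hX.skew n m]
  congr 2; ring

theorem commute {m n : I → ℤ} (h : form Λ m n = 0) : Commute (X m) (X n) := by
  have := hX.mul_comm_smul m n
  rwa [h, mul_zero, qHalf_zero_smul] at this

/-- A monomial that does not commute with all others is different from every scalar; so the
binomials built on it are invertible. -/
theorem one_add_smul_ne_zero [FaithfulSMul Base D] {b m : I → ℤ} (h : form Λ b m ≠ 0) (a : ℤ) :
    1 + qHalf a • X b ≠ 0 := by
  intro h0
  have h1 : qHalf a • (X b * X m) = qHalf a • (X m * X b) := by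
    rw [← smul_mul_assoc, ← mul_smul_comm, eq_neg_of_add_eq_zero_right h0]
    simp
  rw [qHalf_smul_inj, hX.mul_comm_smul, ← sub_eq_zero] at h1
  nth_rw 2 [← one_smul Base (X m * X b)] at h1
  rw [← sub_smul, Algebra.smul_def] at h1
  have h2 := (mul_eq_zero.1 h1).resolve_right (mul_ne_zero (hX.ne_zero m) (hX.ne_zero b))
  rw [← map_zero (algebraMap Base D)] at h2
  have h3 := FaithfulSMul.algebraMap_injective Base D h2
  rw [sub_eq_zero, ← LaurentPolynomial.T_zero] at h3
  have := qHalf_injective h3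
  omega

/-- Integer powers of a quantum binomial. -/
theorem binomial_zpow [FaithfulSMul Base D] {b e : I → ℤ} {d : ℤ} (hd : form Λ b e = -d)
    (hd0 : d ≠ 0) (n : ℤ) :
    (X (e + b) + X e) ^ n = qdilog d (X b) n * X (n • e) := by
  have hne : ∀ a : ℤ, 1 + qHalf a • X b ≠ 0 := hX.one_add_smul_ne_zero (m := e) (by omega)
  have hV : X (e + b) + X e = (1 + qHalf d • X b) * X e := by
    rw [add_comm e b, hX.add_eq b e, hd, neg_neg, add_mul, one_mul, smul_mul_assoc, add_comm]
  symm
  refine eq_zpow_of_recurrence ?_ (W := fun n => qdilog d (X b) n * X (n • e)) ?_ ?_ n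
  · rw [hV]
    exact mul_ne_zero (hne _) (hX.ne_zero _)
  · rw [zero_smul, hX.zero, qdilog_zero, mul_one]
  · intro n
    have h1 : X (n • e) * (1 + qHalf d • X b)
        = (1 + qHalf ((2 * n + 1) * d) • X b) * X (n • e) := by
      rw [mul_add, add_mul, mul_smul_comm, hX.mul_comm_smul, qHalf_smul_smul, hX.skew,
        form_smul_right, hd, mul_one, one_mul, smul_mul_assoc]
      congr 3; ring
    have h2 : X (n • e) * X e = X ((n + 1) • e) := by
      rw [hX.mul, form_smul_left, hX.self, mul_zero, qHalf_zero_smul, add_smul, one_smul]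
    rw [qdilog_add_one hne, hV, mul_assoc, mul_assoc, ← mul_assoc (X _), h1, mul_assoc _ _ (X e),
      h2]

end IsFrame

end Frame

/-! ### Skew-fields of fractions of quantum tori -/

section Fractions

variable {I J : Type*} [Fintype I] [Fintype J]

/-- The skew-field of fractions of a quantum torus. -/
abbrev FracTorus (Λ : Matrix I I ℤ) : Type _ :=
  OreLocalization (nonZeroDivisors (QTorus Λ)) (QTorus Λ)

/-- The inclusion of a quantum torus into its skew-field of fractions, as a map of algebras. -/
def toFrac (Λ : Matrix I I ℤ) : QTorus Λ →ₐ[Base] FracTorus Λ :=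
  { (OreLocalization.numeratorRingHom : QTorus Λ →+* FracTorus Λ) with
    commutes' := fun a => by
      have h : (OreLocalization.numeratorRingHom : QTorus Λ →+* FracTorus Λ) (a • 1) =
        a • (OreLocalization.numeratorRingHom : QTorus Λ →+* FracTorus Λ) 1 :=
        (OreLocalization.smul_oreDiv_one a (1 : QTorus Λ)).symm
      rw [map_one] at h
      rw [Algebra.algebraMap_eq_smul_one, Algebra.algebraMap_eq_smul_one]
      exact h }

theorem toFrac_injective (Λ : Matrix I I ℤ) : Function.Injective (toFrac Λ) :=
  OreLocalization.numeratorHom_inj fun _ hx => (mem_nonZeroDivisors_iff.1 hx).1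

theorem toFrac_ne_zero {Λ : Matrix I I ℤ} {z : QTorus Λ} (hz : z ≠ 0) : toFrac Λ z ≠ 0 :=
  (map_ne_zero_iff _ (toFrac_injective Λ)).2 hz

instance (Λ : Matrix I I ℤ) : FaithfulSMul Base (QTorus Λ) where
  eq_of_smul_eq_smul {a b} h := by
    have h1 := congrArg (QTorus.coeff (Λ := Λ) 0) (h (QTorus.X Λ 0))
    classical
    simpa [QTorus.coeff_X] using h1

instance (Λ : Matrix I I ℤ) : FaithfulSMul Base (FracTorus Λ) where
  eq_of_smul_eq_smul {a b} h := by
    refine FaithfulSMul.eq_of_smul_eq_smul (α := QTorus Λ) fun z => toFrac_injective Λ ?_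
    rw [map_smul, map_smul, h]

/-- An injective map of quantum tori extends to their skew-fields of fractions. -/
def fracMap {Λ : Matrix I I ℤ} {M : Matrix J J ℤ} (φ : QTorus Λ →ₐ[Base] QTorus M)
    (hφ : Function.Injective φ) : FracTorus Λ →ₐ[Base] FracTorus M :=
  let ψ : QTorus Λ →+* FracTorus M := ((toFrac M).comp φ : QTorus Λ →ₐ[Base] FracTorus M)
  have h0 : ∀ s : nonZeroDivisors (QTorus Λ), ψ s.1 ≠ 0 := fun s =>
    toFrac_ne_zero ((map_ne_zero_iff _ hφ).2 (nonZeroDivisors.ne_zero s.2))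
  let u : nonZeroDivisors (QTorus Λ) →* (FracTorus M)ˣ :=
    { toFun := fun s => Units.mk0 (ψ s.1) (h0 s)
      map_one' := Units.ext (map_one ψ)
      map_mul' := fun a b => Units.ext (map_mul ψ a.1 b.1) }
  { OreLocalization.universalHom ψ u (fun _ => rfl) with
    commutes' := fun a => by
      have h1 : algebraMap Base (FracTorus Λ) a = OreLocalization.numeratorHom
        (algebraMap Base (QTorus Λ) a) := ((toFrac Λ).commutes a).symm
      rw [h1]
      refine (OreLocalization.universalHom_commutes ψ u (fun _ => rfl)).trans ?_
      exact ((toFrac M).comp φ).commutes a }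

theorem fracMap_toFrac {Λ : Matrix I I ℤ} {M : Matrix J J ℤ} (φ : QTorus Λ →ₐ[Base] QTorus M)
    (hφ : Function.Injective φ) (z : QTorus Λ) :
    fracMap φ hφ (toFrac Λ z) = toFrac M (φ z) :=
  OreLocalization.universalHom_commutes _ _ _

/-- Finitely many fractions have a common left denominator. -/
theorem exists_common_denominator {Λ : Matrix I I ℤ} {ι : Type*} (S : Finset ι)
    (r : ι → FracTorus Λ) : ∃ (s : QTorus Λ) (p : ι → QTorus Λ), s ≠ 0 ∧
      ∀ i ∈ S, toFrac Λ s * r i = toFrac Λ (p i) := by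
  classical
  induction S using Finset.induction_on with
  | empty => exact ⟨1, fun _ => 0, one_ne_zero, by simp⟩
  | insert j S hj ih =>
    obtain ⟨s, p, hs, h⟩ := ih
    obtain ⟨a, b, hb, hab⟩ : ∃ a b : QTorus Λ, b ≠ 0 ∧ toFrac Λ b * r j = toFrac Λ a := by
      induction r j using OreLocalization.ind with
      | _ a b =>
        refine ⟨a, b, nonZeroDivisors.ne_zero b.2, ?_⟩
        change (((b : QTorus Λ) /ₒ 1 : FracTorus Λ)) * (a /ₒ b) = a /ₒ 1
        rw [OreLocalization.mul_cancel]
    obtain ⟨x, y, hy, hxy⟩ := QTorus.exists_ore s b hb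
    refine ⟨y * s, fun i => if i = j then x * a else y * p i, mul_ne_zero hy hs, fun i hi => ?_⟩
    rcases eq_or_ne i j with rfl | hij
    · simp only [if_true]
      rw [hxy, map_mul, mul_assoc, hab, map_mul]
    · simp only [hij, if_false]
      rw [map_mul, mul_assoc, h i ((Finset.mem_insert.1 hi).resolve_left hij), map_mul]

end Fractions

/-! ### Mutation of quantum seeds -/

section Mutation

/-- The linear map with `f_k ↦ -f_k + ∑ᵢ [-bᵢ]₊ f_i` and `f_i ↦ f_i` for `i ≠ k` (when
`b_k = 0`): it expresses the Laurent exponents after a mutation at `k` in terms of those before,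
where `b` is the `k`-th column of the exchange matrix. -/
def mutVec {J : Type*} [DecidableEq J] (k : J) (b : J → ℤ) : (J → ℤ) →+ (J → ℤ) where
  toFun m := m + m k • ((fun i => max (-b i) 0) - (2 : ℤ) • Pi.single k 1)
  map_zero' := by simp
  map_add' m n := by
    rw [Pi.add_apply, add_smul]
    abel

theorem mutVec_apply {J : Type*} [DecidableEq J] (k : J) (b m : J → ℤ) (i : J) :
    mutVec k b m i = m i + m k * (max (-b i) 0 - 2 * (Pi.single k 1 : J → ℤ) i) := by
  simp [mutVec]

variable {U F : Type*} [Fintype U] [Fintype F] [DecidableEq U] [DecidableEq F]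
variable {t : QuantumSeed U F}

namespace SeedIn

/-- The `k`-th column of the exchange matrix. -/
def col (s : SeedIn t) (k : U) : U ⊕ F → ℤ := fun i => s.B i k

/-- The exponent `-f_k + ∑ᵢ [-b_{ik}]₊ f_i` of one of the two monomials of a mutated variable. -/
def mutExp (s : SeedIn t) (k : U) : U ⊕ F → ℤ :=
  -f (Sum.inl k) + fun i => max (-s.B i k) 0

/-- The properties of a seed in `Frac t` that mutations preserve: its Laurent monomials multiply
as in a quantum torus, and its exchange matrix is compatible with `Λ`, with the multipliers of
`t`. -/
structure IsCompatible (s : SeedIn t) : Prop where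
  frame : IsFrame s.Λ s.X
  compat : ∀ k m, form s.Λ (s.col k) m = t.d k * m (Sum.inl k)

end SeedIn

theorem form_sum_smul {J ι : Type*} [Fintype J] [Fintype ι] (Λ : Matrix J J ℤ) (e : ι → J → ℤ)
    (m n : ι → ℤ) :
    form Λ (∑ i, m i • e i) (∑ i, n i • e i) = form (fun i j => form Λ (e i) (e j)) m n := by
  have h1 : ∀ (v : ι → J → ℤ) (w : J → ℤ), form Λ (∑ i, v i) w = ∑ i, form Λ (v i) w := by
    simp [form, sum_dotProduct]
  have h2 : ∀ (v : ι → J → ℤ) (w : J → ℤ), form Λ w (∑ i, v i) = ∑ i, form Λ w (v i) := by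
    simp [form, dotProduct_sum, Matrix.mulVec_sum]
  simp only [h1, h2, form_smul_left, form_smul_right]
  change _ = m ⬝ᵥ _
  rw [dotProduct]
  refine Finset.sum_congr rfl fun i _ => ?_
  change _ = m i * ∑ j, form Λ (e i) (e j) * n j
  rw [Finset.mul_sum]
  refine Finset.sum_congr rfl fun j _ => ?_
  ring

theorem isFrame_toFrac (t : QuantumSeed U F) : IsFrame t.Λ fun m => incl t (QTorus.X t.Λ m) where
  zero := (toFrac t.Λ).map_one
  mul m n := by
    refine ((toFrac t.Λ).map_mul (QTorus.X t.Λ m) (QTorus.X t.Λ n)).symm.trans ?_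
    rw [QTorus.X_mul_X]
    exact map_smul (toFrac t.Λ) _ _
  skew m n := by
    rw [form, form, Matrix.dotProduct_mulVec, ← Matrix.mulVec_transpose, t.skew, Matrix.neg_mulVec,
      neg_dotProduct, dotProduct_comm]

theorem form_mulVec_left (t : QuantumSeed U F) (n : U → ℤ) (m : U ⊕ F → ℤ) :
    form t.Λ (t.B *ᵥ n) m = ∑ k, t.d k * n k * m (Sum.inl k) := by
  have h : (t.B *ᵥ n) ᵥ* t.Λ = n ᵥ* (t.Bᵀ * t.Λ) := by
    rw [← Matrix.vecMul_transpose, Matrix.vecMul_vecMul]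
  rw [form, Matrix.dotProduct_mulVec, h, t.compatible, Matrix.vecMul_fromCols, dotProduct,
    Fintype.sum_sum_type]
  simp [Matrix.vecMul_diagonal, mul_comm]

namespace SeedIn

theorem isCompatible_initial (t : QuantumSeed U F) : (initial t).IsCompatible where
  frame := isFrame_toFrac t
  compat k m := by
    have h : (initial t).col k = t.B *ᵥ Pi.single k 1 := by
      ext i
      simp [col, initial]
    rw [h, initial, form_mulVec_left, Finset.sum_eq_single k]
    · simp
    · intro j _ hj
      simp [hj]
    · simp

theorem mutVec_eq_sum (s : SeedIn t) (k : U) (m : U ⊕ F → ℤ) :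
    mutVec (Sum.inl k) (s.col k) m = ∑ i, m i • (if i = Sum.inl k then
      -f (Sum.inl k) + fun j => max (-s.B j k) 0 else f i : U ⊕ F → ℤ) := by
  have h : ∀ i, (if i = Sum.inl k then -f (Sum.inl k) + fun j => max (-s.B j k) 0 else f i :
      U ⊕ F → ℤ) = f i + if i = Sum.inl k then (fun j => max (-s.B j k) 0) -
        (2 : ℤ) • f (Sum.inl k) else 0 := by
    intro i
    split_ifs with hi
    · rw [hi, two_smul]; abel
    · rw [add_zero]
  simp_rw [h, smul_add, Finset.sum_add_distrib, smul_ite, smul_zero, Finset.sum_ite_eq',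
    Finset.mem_univ, if_true]
  rw [← pi_eq_sum_univ' m]
  rfl

theorem form_mutΛ (s : SeedIn t) (k : U) (m n : U ⊕ F → ℤ) :
    form (s.mutΛ k) m n =
      form s.Λ (mutVec (Sum.inl k) (s.col k) m) (mutVec (Sum.inl k) (s.col k) n) := by
  rw [mutVec_eq_sum, mutVec_eq_sum, form_sum_smul]
  rfl

namespace IsCompatible

variable {s : SeedIn t} (hs : s.IsCompatible)
include hs

theorem col_col (j k : U) : form s.Λ (s.col j) (s.col k) = t.d j * s.B (Sum.inl j) k :=
  hs.compat j (s.col k)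

theorem B_self (k : U) : s.B (Sum.inl k) k = 0 := by
  have h := hs.col_col k k
  rw [hs.frame.self] at h
  exact (mul_eq_zero.1 h.symm).resolve_left (t.d_pos k).ne'

/-- The principal part of the exchange matrix is skew-symmetrizable. -/
theorem d_mul_B (j k : U) : t.d j * s.B (Sum.inl j) k = -(t.d k * s.B (Sum.inl k) j) := by
  rw [← hs.col_col, ← hs.col_col, hs.frame.skew]

/-- In the exponents before the mutation, the new columns are obtained from the old ones by a
substitution that involves only the principal part. -/
theorem mutVec_col (j k : U) :
    mutVec (Sum.inl k) (s.col k) ((s.mutate k).col j) =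
      if j = k then -s.col k else s.col j + max (s.B (Sum.inl k) j) 0 • s.col k := by
  have h0 := hs.B_self k
  ext i
  rw [mutVec_apply]
  split_ifs with hj
  · subst hj
    simp [col, mutate, mutB, h0]
  · have h1 : s.B (Sum.inl k) j = max (s.B (Sum.inl k) j) 0 - max (-s.B (Sum.inl k) j) 0 := by
      rcases le_total (s.B (Sum.inl k) j) 0 with h | h <;> simp [h]
    have h2 : s.B i k = max (s.B i k) 0 - max (-s.B i k) 0 := by
      rcases le_total (s.B i k) 0 with h | h <;> simp [h]
    by_cases hi : i = Sum.inl k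
    · subst hi
      simp [col, mutate, mutB, h0]
      ring
    · simp only [col, mutate, mutB, hi, hj, or_self, if_false, true_or, if_true, Pi.add_apply,
        Pi.smul_apply, smul_eq_mul, Pi.single_eq_of_ne hi, mul_zero, sub_zero]
      generalize max (s.B (Sum.inl k) j) 0 = x at *
      generalize max (-s.B (Sum.inl k) j) 0 = y at *
      generalize max (s.B i k) 0 = z at *
      generalize max (-s.B i k) 0 = w at *
      rw [h1, h2]
      ring

theorem mutVec_eq (k : U) (m : U ⊕ F → ℤ) :
    mutVec (Sum.inl k) (s.col k) m =
      m - Pi.single (Sum.inl k) (m (Sum.inl k)) + m (Sum.inl k) • s.mutExp k := by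
  ext i
  simp only [mutVec_apply, mutExp, Pi.smul_apply, Pi.add_apply, Pi.sub_apply, Pi.neg_apply,
    smul_eq_mul]
  by_cases hi : i = Sum.inl k
  · subst hi
    simp [hs.B_self k, col]
    ring
  · simp [hi, col]

theorem form_col_mutExp (k : U) : form s.Λ (s.col k) (s.mutExp k) = -t.d k := by
  rw [hs.compat, mutExp]
  simp [hs.B_self k]

theorem form_col_sub_single (k : U) (m : U ⊕ F → ℤ) :
    form s.Λ (s.col k) (m - Pi.single (Sum.inl k) (m (Sum.inl k))) = 0 := by
  rw [hs.compat, Pi.sub_apply, Pi.single_eq_same, sub_self, mul_zero]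

/-- Integer powers of the mutated variable. -/
theorem mutVar_zpow (k : U) (a : ℤ) :
    s.mutVar k ^ a = qdilog (t.d k) (s.X (s.col k)) a * s.X (a • s.mutExp k) := by
  have hV : s.mutVar k = s.X (s.mutExp k + s.col k) + s.X (s.mutExp k) := by
    rw [mutVar, mutExp]
    congr 2
    ext i
    rcases le_total (s.B i k) 0 with h | h <;> simp [h, col]
  rw [hV, hs.frame.binomial_zpow (hs.form_col_mutExp k) (t.d_pos k).ne']

theorem commute_qdilog_col (k : U) (m : U ⊕ F → ℤ) (a : ℤ) :
    Commute (s.X (m - Pi.single (Sum.inl k) (m (Sum.inl k))))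
      (qdilog (t.d k) (s.X (s.col k)) a) :=
  commute_qdilog (hs.frame.commute (by
    rw [hs.frame.skew, hs.form_col_sub_single, neg_zero])) _ _

/-- The definition of the mutated monomials, with the twist evaluated in the old form. -/
theorem mutate_X_eq_zpow (k : U) (m : U ⊕ F → ℤ) :
    (s.mutate k).X m =
      qHalf (-(m (Sum.inl k) * form s.Λ (m - Pi.single (Sum.inl k) (m (Sum.inl k)))
        (s.mutExp k))) •
      (s.X (m - Pi.single (Sum.inl k) (m (Sum.inl k))) * s.mutVar k ^ m (Sum.inl k)) := by
  have h : form (s.mutΛ k) (m - Pi.single (Sum.inl k) (m (Sum.inl k)))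
      (Pi.single (Sum.inl k) (m (Sum.inl k))) = m (Sum.inl k) *
        form s.Λ (m - Pi.single (Sum.inl k) (m (Sum.inl k))) (s.mutExp k) := by
    rw [form_mutΛ, hs.mutVec_eq, hs.mutVec_eq, ← form_smul_right]
    simp
  rw [← h]
  rfl

/-- The Laurent monomials of a mutated seed in terms of those of the seed itself. -/
theorem mutate_X (k : U) (m : U ⊕ F → ℤ) :
    (s.mutate k).X m = qdilog (t.d k) (s.X (s.col k)) (m (Sum.inl k)) *
      s.X (mutVec (Sum.inl k) (s.col k) m) := by
  rw [hs.mutate_X_eq_zpow, hs.mutVar_zpow, ← mul_assoc, (hs.commute_qdilog_col k m _).eq,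
    mul_assoc, hs.frame.mul, mul_smul_comm, qHalf_smul_smul, hs.mutVec_eq, form_smul_right,
    neg_add_cancel, qHalf_zero_smul]

theorem mutVar_zpow_mul (k : U) (a : ℤ) (n : U ⊕ F → ℤ) :
    s.mutVar k ^ a * s.X (n - Pi.single (Sum.inl k) (n (Sum.inl k))) =
      qHalf (2 * (a * form s.Λ (s.mutExp k) (n - Pi.single (Sum.inl k) (n (Sum.inl k))))) •
        (s.X (n - Pi.single (Sum.inl k) (n (Sum.inl k))) * s.mutVar k ^ a) := by
  rw [hs.mutVar_zpow, mul_assoc, hs.frame.mul_comm_smul, mul_smul_comm, ← mul_assoc,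
    ← (hs.commute_qdilog_col k n a).eq, mul_assoc, form_smul_left]

theorem mutate_mul (k : U) (m n : U ⊕ F → ℤ) :
    (s.mutate k).X m * (s.mutate k).X n =
      qHalf (form (s.mutΛ k) m n) • (s.mutate k).X (m + n) := by
  have hV : s.mutVar k ≠ 0 := by
    have h := hs.mutVar_zpow k 1
    intro h0
    rw [h0, zpow_one, one_smul, ← zero_add (1 : ℤ), qdilog_add_one
      (hs.frame.one_add_smul_ne_zero (m := s.mutExp k) (by
        rw [hs.form_col_mutExp]; exact neg_ne_zero.2 (t.d_pos k).ne')), qdilog_zero, one_mul] at h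
    refine mul_ne_zero (hs.frame.one_add_smul_ne_zero (m := s.mutExp k) (by
        rw [hs.form_col_mutExp]; exact neg_ne_zero.2 (t.d_pos k).ne') _) (hs.frame.ne_zero _) h.symm
  have hadd : m + n - Pi.single (Sum.inl k) ((m + n) (Sum.inl k)) =
      (m - Pi.single (Sum.inl k) (m (Sum.inl k))) + (n - Pi.single (Sum.inl k) (n (Sum.inl k))) := by
    rw [Pi.add_apply, Pi.single_add]
    abel
  rw [hs.mutate_X_eq_zpow, hs.mutate_X_eq_zpow, hs.mutate_X_eq_zpow, smul_mul_smul_comm,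
    mul_assoc, ← mul_assoc (s.mutVar k ^ _), hs.mutVar_zpow_mul, smul_mul_assoc, mul_smul_comm,
    mul_assoc (s.X _) (s.mutVar k ^ _), ← zpow_add₀ hV, ← mul_assoc (s.X _) (s.X _), hs.frame.mul, hadd,
    Pi.add_apply, smul_mul_assoc, form_mutΛ, hs.mutVec_eq, hs.mutVec_eq]
  generalize m - Pi.single (Sum.inl k) (m (Sum.inl k)) = m₀
  generalize n - Pi.single (Sum.inl k) (n (Sum.inl k)) = n₀
  simp only [← LaurentPolynomial.T_add, smul_smul, form_add_left, form_add_right, form_smul_left,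
    form_smul_right, hs.frame.self]
  rw [hs.frame.skew n₀ (s.mutExp k)]
  congr 2
  ring

theorem mutate (k : U) : (s.mutate k).IsCompatible where
  frame :=
    { zero := by
        rw [hs.mutate_X, map_zero, hs.frame.zero, mul_one, Pi.zero_apply, qdilog_zero]
      mul := hs.mutate_mul k
      skew := fun m n => by
        change form (s.mutΛ k) m n = -form (s.mutΛ k) n m
        rw [form_mutΛ, form_mutΛ, hs.frame.skew] }
  compat j m := by
    change form (s.mutΛ k) _ _ = _
    rw [form_mutΛ, hs.mutVec_col]
    split_ifs with hj
    · rw [form_neg_left, hs.compat, mutVec_apply, hj]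
      simp [col, hs.B_self k]
      ring
    · have hjk : Sum.inl j ≠ (Sum.inl k : U ⊕ F) := fun h => hj (Sum.inl_injective h)
      have h1 := hs.d_mul_B k j
      have h2 : t.d k * max (s.B (Sum.inl k) j) 0 = t.d j * max (-s.B (Sum.inl j) k) 0 := by
        rw [mul_max_of_nonneg _ _ (t.d_pos k).le, mul_max_of_nonneg _ _ (t.d_pos j).le, mul_zero,
          mul_zero, h1, mul_neg]
      rw [form_add_left, form_smul_left, hs.compat, hs.compat, mutVec_apply, mutVec_apply]
      simp only [Pi.single_eq_same, Pi.single_eq_of_ne hjk, col, hs.B_self k, neg_zero, max_self]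
      linear_combination (-m (Sum.inl k)) * h2

end IsCompatible

end SeedIn

end Mutation

/-! ### The torus of `Y`-monomials -/

section YTorus

variable {I J : Type*} [Fintype I] [Fintype J]

namespace QTorus

/-- The map of quantum tori `X^m ↦ X^{e m}` given by an isometry `e` of the exponent lattices. -/
def map {Λ : Matrix I I ℤ} {M : Matrix J J ℤ} (e : (I → ℤ) →+ (J → ℤ))
    (he : ∀ m n, form M (e m) (e n) = form Λ m n) : QTorus Λ →ₐ[Base] QTorus M :=
  AlgHom.ofLinearMap ((monomialBasis Λ).constr Base fun m => X M (e m))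
    (by
      rw [one_def, X, Module.Basis.constr_basis, map_zero]
      rfl)
    (fun z w => by
      have hX : ∀ m, (monomialBasis Λ).constr Base (fun m => X M (e m)) (X Λ m) = X M (e m) :=
        fun m => Module.Basis.constr_basis _ _ _ m
      induction z using QTorus.induction with
      | h0 => simp
      | hadd u v hu hv => simp only [add_mul, map_add, hu, hv]
      | hX a l =>
      induction w using QTorus.induction with
      | h0 => simp
      | hadd u v hu hv => simp only [mul_add, map_add, hu, hv]
      | hX b n =>
      simp only [QTorus.smul_mul, QTorus.mul_smul, X_mul_X, map_smul, hX, map_add, he])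

theorem map_X {Λ : Matrix I I ℤ} {M : Matrix J J ℤ} (e : (I → ℤ) →+ (J → ℤ))
    (he : ∀ m n, form M (e m) (e n) = form Λ m n) (m : I → ℤ) :
    map e he (X Λ m) = X M (e m) := by
  rw [map, AlgHom.ofLinearMap_apply, X, Module.Basis.constr_basis]

theorem map_injective {Λ : Matrix I I ℤ} {M : Matrix J J ℤ} (e : (I → ℤ) →+ (J → ℤ))
    (he : ∀ m n, form M (e m) (e n) = form Λ m n) (hinj : Function.Injective e) :
    Function.Injective (map e he) := by
  classical
  have h : ∀ (n : I → ℤ) (z : QTorus Λ), coeff (e n) (map e he z) = coeff n z := by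
    intro n z
    induction z using QTorus.induction with
    | h0 => simp
    | hadd u v hu hv => simp only [map_add, hu, hv]
    | hX a l => simp only [map_smul, map_X, coeff_X, hinj.eq_iff]
  intro z w hzw
  exact coeff_ext fun m => by rw [← h, ← h, hzw]

end QTorus

variable {U F : Type*} [Fintype U] [Fintype F] [DecidableEq U] [DecidableEq F]

/-- The matrix of the form `Λ(B k, B l) = d_k b_{kl}` on the lattice of exponents of the `Yⁿ`. It
depends only on the principal part `b` and on the multipliers `d`. -/
def yForm (b : Matrix U U ℤ) (d : U → ℤ) : Matrix U U ℤ := fun k l => d k * b k l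

/-- The seed `t` has principal part `b` and multipliers `d`, up to the relabelling `τ` of the
unfrozen vertices. -/
structure HasPrincipalPart (b : Matrix U U ℤ) (d : U → ℤ) (τ : Equiv.Perm U)
    (t : QuantumSeed U F) : Prop where
  B_eq : ∀ i j, t.B (Sum.inl (τ i)) (τ j) = b i j
  d_eq : ∀ k, t.d (τ k) = d k

/-- The unfrozen part of an exponent vector, relabelled by `τ`. -/
def unfrozen (F : Type*) (τ : Equiv.Perm U) : (U ⊕ F → ℤ) →+ (U → ℤ) where
  toFun m i := m (Sum.inl (τ i))
  map_zero' := rfl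
  map_add' _ _ := rfl

theorem unfrozen_apply (τ : Equiv.Perm U) (m : U ⊕ F → ℤ) (i : U) :
    unfrozen F τ m i = m (Sum.inl (τ i)) := rfl

/-- The exponent of `Y^{τ n}` in the seed `t`. -/
def yExp (t : QuantumSeed U F) (τ : Equiv.Perm U) : (U → ℤ) →+ (U ⊕ F → ℤ) where
  toFun n := t.B *ᵥ permute τ n
  map_zero' := Matrix.mulVec_zero _
  map_add' _ _ := Matrix.mulVec_add _ _ _

namespace HasPrincipalPart

variable {b : Matrix U U ℤ} {d : U → ℤ} {τ : Equiv.Perm U} {t : QuantumSeed U F}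
  (h : HasPrincipalPart b d τ t)
include h

theorem unfrozen_yExp (n : U → ℤ) : unfrozen F τ (yExp t τ n) = b *ᵥ n := by
  ext i
  change ∑ j, t.B (Sum.inl (τ i)) j * n (τ.symm j) = ∑ j, b i j * n j
  rw [← Equiv.sum_comp τ]
  simp [h.B_eq]

theorem form_yExp_left (n : U → ℤ) (m : U ⊕ F → ℤ) :
    form t.Λ (yExp t τ n) m = ∑ k, d k * n k * unfrozen F τ m k := by
  refine (form_mulVec_left t _ m).trans ?_
  rw [← Equiv.sum_comp τ]
  simp [permute, h.d_eq, unfrozen_apply]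

theorem form_yExp (n n' : U → ℤ) :
    form t.Λ (yExp t τ n) (yExp t τ n') = form (yForm b d) n n' := by
  rw [h.form_yExp_left, h.unfrozen_yExp, form, dotProduct]
  refine Finset.sum_congr rfl fun k _ => ?_
  change _ = n k * ∑ l, d k * b k l * n' l
  simp only [Matrix.mulVec, dotProduct, Finset.mul_sum]
  refine Finset.sum_congr rfl fun l _ => ?_
  ring

theorem d_pos (k : U) : 0 < d k := h.d_eq k ▸ t.d_pos (τ k)

theorem yExp_injective : Function.Injective (yExp t τ) := by
  rw [injective_iff_map_eq_zero]
  intro n hn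
  ext k
  have h1 := h.form_yExp_left n (Pi.single (Sum.inl (τ k)) 1)
  rw [hn, form_zero_left, Finset.sum_eq_single k] at h1
  · simpa [unfrozen_apply, (h.d_pos k).ne'] using h1.symm
  · intro j _ hj
    simp [unfrozen_apply, hj]
  · simp

/-- The map `Yⁿ ↦ Y^{τ n}` from the torus of `Y`-monomials to `LP(t)`. -/
def yMap : QTorus (yForm b d) →ₐ[Base] LP t := QTorus.map (yExp t τ) h.form_yExp

theorem yMap_X (n : U → ℤ) : h.yMap (QTorus.X _ n) = QTorus.X t.Λ (yExp t τ n) :=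
  QTorus.map_X _ _ n

theorem yMap_injective : Function.Injective h.yMap :=
  QTorus.map_injective _ _ h.yExp_injective

/-- The map from the fractions of the torus of `Y`-monomials to the skew-field `Frac t`. -/
def yFrac : FracTorus (yForm b d) →ₐ[Base] Frac t := fracMap h.yMap h.yMap_injective

theorem yFrac_toFrac (z : QTorus (yForm b d)) :
    h.yFrac (toFrac _ z) = toFrac t.Λ (h.yMap z) :=
  fracMap_toFrac _ _ z

end HasPrincipalPart

end YTorus

/-! ### The seed pattern modulo frozen variables -/

section Pattern

variable {U F : Type*} [Fintype U] [Fintype F] [DecidableEq U] [DecidableEq F]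

/-- What remains of a seed when the frozen variables are disregarded: its principal part `mat`,
the unfrozen parts `deg m` of the degrees of its Laurent monomials, its `c`-vectors `c k`, and the
fractions `R m` in the `Y`-monomials of the initial seed which are the quotients of its Laurent
monomials by the initial Laurent monomials of the same degree. All of this depends only on the
principal part `b` and on the multipliers `d` of the initial seed. -/
structure PatternSeed (b : Matrix U U ℤ) (d : U → ℤ) where
  mat : Matrix U U ℤ
  deg : (U → ℤ) →+ (U → ℤ)
  c : U → U → ℤ
  R : (U → ℤ) → FracTorus (yForm b d)

namespace PatternSeed

variable {b : Matrix U U ℤ} {d : U → ℤ}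

variable (b d) in
/-- The initial seed of the pattern. -/
def initial : PatternSeed b d where
  mat := b
  deg := AddMonoidHom.id _
  c k := Pi.single k 1
  R _ := 1

/-- The mutation of pattern seeds. -/
def mutate (a : PatternSeed b d) (k : U) : PatternSeed b d where
  mat i j := if i = k ∨ j = k then -a.mat i j
    else a.mat i j + (max (a.mat i k) 0 * max (a.mat k j) 0
      - max (-a.mat i k) 0 * max (-a.mat k j) 0)
  deg := a.deg.comp (mutVec k fun i => a.mat i k)
  c j := if j = k then -a.c k else a.c j + max (a.mat k j) 0 • a.c k
  R m := qdilog (d k) (a.R (fun i => a.mat i k) * toFrac _ (QTorus.X _ (a.c k))) (m k) *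
    a.R (mutVec k (fun i => a.mat i k) m)

variable (b d) in
/-- The pattern seeds obtained from the initial one by iterated mutations. -/
inductive Reachable : PatternSeed b d → Prop
  | initial : Reachable (initial b d)
  | mutate (a : PatternSeed b d) (k : U) : Reachable a → Reachable (a.mutate k)

/-- The pattern seed `a` describes the seed `s` in `Frac t`, where `γ` gives the degrees in
`LP(t)` of the Laurent monomials of `s`. -/
structure Describes {τ : Equiv.Perm U} {t : QuantumSeed U F} (h : HasPrincipalPart b d τ t)
    (a : PatternSeed b d) (s : SeedIn t) (γ : (U ⊕ F → ℤ) →+ (U ⊕ F → ℤ)) : Prop where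
  compat : s.IsCompatible
  mat_eq : ∀ i j, s.B (Sum.inl (τ i)) (τ j) = a.mat i j
  frozen : ∀ m, unfrozen F τ m = 0 → γ m = m
  deg_eq : ∀ m, unfrozen F τ (γ m) = a.deg (unfrozen F τ m)
  col_eq : ∀ k, γ (s.col (τ k)) = yExp t τ (a.c k)
  X_eq : ∀ m, s.X m = h.yFrac (a.R (unfrozen F τ m)) * toFrac t.Λ (QTorus.X t.Λ (γ m))

variable {τ : Equiv.Perm U} {t : QuantumSeed U F} {h : HasPrincipalPart b d τ t}

theorem describes_initial :
    Describes h (initial b d) (SeedIn.initial t) (AddMonoidHom.id _) where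
  compat := SeedIn.isCompatible_initial t
  mat_eq := h.B_eq
  frozen _ _ := rfl
  deg_eq _ := rfl
  col_eq k := by
    ext i
    change t.B i (τ k) = ∑ j, t.B i j * (Pi.single k 1 : U → ℤ) (τ.symm j)
    rw [← Equiv.sum_comp τ]
    simp [Pi.single_apply]
  X_eq m := by
    change _ = h.yFrac 1 * _
    rw [map_one, one_mul]
    rfl

/-- Mutations of pattern seeds describe mutations of seeds. In each step the new degree map is the
old one composed with `mutVec`, whatever the sign of the `c`-vector, so no sign-coherence is
needed. -/
theorem Describes.mutate {a : PatternSeed b d} {s : SeedIn t}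
    {γ : (U ⊕ F → ℤ) →+ (U ⊕ F → ℤ)} (ha : Describes h a s γ) (k : U) :
    Describes h (a.mutate k) (s.mutate (τ k))
      (γ.comp (mutVec (Sum.inl (τ k)) (s.col (τ k)))) := by
  have hcol : unfrozen F τ (s.col (τ k)) = fun i => a.mat i k := by
    ext i
    exact ha.mat_eq i k
  have hvec : ∀ m, unfrozen F τ (mutVec (Sum.inl (τ k)) (s.col (τ k)) m) =
      mutVec k (fun i => a.mat i k) (unfrozen F τ m) := by
    intro m
    ext i
    have h1 : s.col (τ k) (Sum.inl (τ i)) = a.mat i k := ha.mat_eq i k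
    rw [unfrozen_apply, mutVec_apply, mutVec_apply, h1]
    simp [unfrozen_apply, Pi.single_apply]
  refine ⟨ha.compat.mutate _, fun i j => ?_, fun m hm => ?_, fun m => ?_, fun j => ?_,
    fun m => ?_⟩
  · simp [SeedIn.mutate, SeedIn.mutB, PatternSeed.mutate, ha.mat_eq]
  · have h1 : mutVec (Sum.inl (τ k)) (s.col (τ k)) m = m := by
      ext i
      have : m (Sum.inl (τ k)) = 0 := congrFun hm k
      rw [mutVec_apply, this, zero_mul, add_zero]
    rw [AddMonoidHom.comp_apply, h1, ha.frozen m hm]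
  · rw [AddMonoidHom.comp_apply, ha.deg_eq, hvec]
    rfl
  · rw [AddMonoidHom.comp_apply, ha.compat.mutVec_col]
    by_cases hj : j = k
    · subst hj
      simp [PatternSeed.mutate, ha.col_eq]
    · rw [if_neg (fun e => hj (τ.injective e)), map_add, map_zsmul, ha.col_eq, ha.col_eq,
        ha.mat_eq, ← map_zsmul, ← map_add]
      simp only [PatternSeed.mutate, if_neg hj]
  · have h1 : s.X (s.col (τ k)) = h.yFrac (a.R (fun i => a.mat i k) *
        toFrac _ (QTorus.X _ (a.c k))) := by
      rw [ha.X_eq, hcol, ha.col_eq, map_mul, h.yFrac_toFrac, h.yMap_X]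
    rw [ha.compat.mutate_X, h1, ← map_qdilog, h.d_eq, ha.X_eq, hvec, ← mul_assoc, ← map_mul]
    rfl

theorem exists_describes_of_reachable {s : SeedIn t} (hs : QuantumCluster.Reachable t s) :
    ∃ a γ, Reachable b d a ∧ Describes h a s γ := by
  induction hs with
  | initial => exact ⟨_, _, Reachable.initial, describes_initial⟩
  | mutate s k _ ih =>
    obtain ⟨a, γ, ha, hd⟩ := ih
    have := hd.mutate (τ.symm k)
    rw [τ.apply_symm_apply] at this
    exact ⟨_, _, ha.mutate _ _, this⟩

variable (h) in
theorem Reachable.exists_describes {a : PatternSeed b d} (ha : Reachable b d a) :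
    ∃ s γ, QuantumCluster.Reachable t s ∧ Describes h a s γ := by
  induction ha with
  | initial => exact ⟨_, _, .initial, describes_initial⟩
  | mutate a k _ ih =>
    obtain ⟨s, γ, hs, hd⟩ := ih
    exact ⟨_, _, hs.mutate _ _, hd.mutate k⟩

end PatternSeed

end Pattern

/-! ### Homogeneous elements -/

section Homogeneous

variable {U F : Type*} [Fintype U] [Fintype F] [DecidableEq U] [DecidableEq F]

/-- The Laurent polynomial `X^g · ∑ₙ cₙ Y^{τ n}` (commutative product), for a finitely supported
family `c` indexed by `ℤ^U`. For fixed `g` these are the elements of `LP(t)` that are homogeneous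
for the grading by `ℤ^I / B ℤ^U`. -/
def ser (t : QuantumSeed U F) (τ : Equiv.Perm U) (g : U ⊕ F → ℤ) :
    ((U → ℤ) →₀ Base) →ₗ[Base] LP t :=
  Finsupp.linearCombination Base fun n => QTorus.X t.Λ (g + yExp t τ n)

/-- The twist `c_n ↦ q^{-(∑ₖ d_k n_k u_k)/2} c_n`: it compares the twisted and the commutative
product of a monomial of unfrozen degree `u` with a polynomial in the `Y`-monomials. -/
def twist (d u : U → ℤ) : ((U → ℤ) →₀ Base) →ₗ[Base] ((U → ℤ) →₀ Base) :=
  Finsupp.linearCombination Base fun n => Finsupp.single n (qHalf (-∑ k, d k * n k * u k))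

/-- The element `r` of the torus of `Y`-monomials with `X^g · ∑ₙ cₙ Yⁿ = r * X^g`, where `u` is
the unfrozen part of `g`. It is independent of the frozen part of `g`, since the frozen variables
commute with the `Yⁿ`. -/
def leftCoeff (b : Matrix U U ℤ) (d u : U → ℤ) : ((U → ℤ) →₀ Base) →ₗ[Base] QTorus (yForm b d) :=
  (Finsupp.linearCombination Base fun n => QTorus.X (yForm b d) n).comp (twist d u)

/-- The homogeneous component, of the degree of `X^g`, of an element of `LP(t)`. -/
def homPart (t : QuantumSeed U F) (τ : Equiv.Perm U) (g : U ⊕ F → ℤ) : LP t →ₗ[Base] LP t :=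
  open Classical in
  (QTorus.monomialBasis t.Λ).constr Base fun m =>
    if ∃ n, m = g + yExp t τ n then QTorus.X t.Λ m else 0

variable {t : QuantumSeed U F} {τ : Equiv.Perm U}

theorem ser_single (g : U ⊕ F → ℤ) (n : U → ℤ) (a : Base) :
    ser t τ g (Finsupp.single n a) = a • QTorus.X t.Λ (g + yExp t τ n) := by
  rw [ser, Finsupp.linearCombination_single]

theorem ser_add_yExp (g : U ⊕ F → ℤ) (n : U → ℤ) (c : (U → ℤ) →₀ Base) :
    ser t τ (g + yExp t τ n) c = ser t τ g (c.mapDomain (n + ·)) := by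
  rw [ser, ser, Finsupp.linearCombination_mapDomain]
  congr 2
  ext m
  simp [add_assoc]

open Classical in
theorem homPart_X (g m : U ⊕ F → ℤ) :
    homPart t τ g (QTorus.X t.Λ m) = if ∃ n, m = g + yExp t τ n then QTorus.X t.Λ m else 0 := by
  exact Module.Basis.constr_basis _ _ _ m

open Classical in
theorem homPart_ser (g g' : U ⊕ F → ℤ) (c : (U → ℤ) →₀ Base) :
    homPart t τ g (ser t τ g' c) = if ∃ n, g' = g + yExp t τ n then ser t τ g' c else 0 := by
  induction c using Finsupp.induction_linear with
  | zero => simp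
  | add c c' hc hc' =>
    rw [map_add, map_add, hc, hc']
    split_ifs <;> simp
  | single n a =>
    have h : (∃ k, g' + yExp t τ n = g + yExp t τ k) ↔ ∃ k, g' = g + yExp t τ k := by
      constructor
      · rintro ⟨k, hk⟩
        exact ⟨k - n, by rw [map_sub, ← add_sub_assoc, ← hk, add_sub_cancel_right]⟩
      · rintro ⟨k, rfl⟩
        exact ⟨k + n, by rw [map_add, add_assoc]⟩
    rw [ser_single, map_smul, homPart_X]
    simp only [h]
    split_ifs <;> simp

theorem homPart_self (g : U ⊕ F → ℤ) (c : (U → ℤ) →₀ Base) :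
    homPart t τ g (ser t τ g c) = ser t τ g c := by
  rw [homPart_ser, if_pos ⟨0, by simp⟩]

theorem exists_homPart_eq_ser (g : U ⊕ F → ℤ) (z : LP t) :
    ∃ c, homPart t τ g z = ser t τ g c := by
  suffices h : homPart t τ g z ∈ LinearMap.range (ser t τ g) from
    h.imp fun _ hc => hc.symm
  induction z using QTorus.induction with
  | h0 => simp
  | hadd z w hz hw => rw [map_add]; exact add_mem hz hw
  | hX a m =>
    rw [map_smul, homPart_X]
    refine Submodule.smul_mem _ _ ?_
    split_ifs with hm
    · obtain ⟨n, rfl⟩ := hm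
      exact ⟨Finsupp.single n 1, by rw [ser_single, one_smul]⟩
    · exact zero_mem _

theorem twist_single (d u n : U → ℤ) (a : Base) :
    twist d u (Finsupp.single n a) = a • Finsupp.single n (qHalf (-∑ k, d k * n k * u k)) := by
  rw [twist, Finsupp.linearCombination_single]

namespace HasPrincipalPart

variable {b : Matrix U U ℤ} {d : U → ℤ} (h : HasPrincipalPart b d τ t)
include h

theorem ser_injective (g : U ⊕ F → ℤ) : Function.Injective (ser t τ g) :=
  (QTorus.monomialBasis t.Λ).linearIndependent.comp (fun n => g + yExp t τ n)
    fun _ _ hn => h.yExp_injective (add_left_cancel hn)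

theorem ser_eq_mul (g : U ⊕ F → ℤ) (c : (U → ℤ) →₀ Base) :
    ser t τ g c = h.yMap (leftCoeff b d (unfrozen F τ g) c) * QTorus.X t.Λ g := by
  induction c using Finsupp.induction_linear with
  | zero => simp
  | add c c' hc hc' => rw [map_add, map_add, map_add, add_mul, hc, hc']
  | single n a =>
    rw [ser_single, leftCoeff, LinearMap.comp_apply, twist_single, map_smul,
      Finsupp.linearCombination_single, map_smul, map_smul, h.yMap_X, QTorus.smul_mul,
      QTorus.smul_mul, QTorus.X_mul_X, h.form_yExp_left, qHalf_smul_smul, neg_add_cancel,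
      qHalf_zero_smul, add_comm g]

theorem X_mul_ser (m g : U ⊕ F → ℤ) (c : (U → ℤ) →₀ Base) :
    QTorus.X t.Λ m * ser t τ g c =
      qHalf (form t.Λ m g) • ser t τ (g + m) (twist d (unfrozen F τ m) c) := by
  induction c using Finsupp.induction_linear with
  | zero => simp
  | add c c' hc hc' => rw [map_add, map_add, map_add, mul_add, smul_add, hc, hc']
  | single n a =>
    rw [ser_single, twist_single, map_smul, ser_single, QTorus.mul_smul, QTorus.X_mul_X,
      form_add_right, (isFrame_toFrac t).skew m (yExp t τ n), h.form_yExp_left,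
      smul_comm (qHalf _) a, qHalf_smul_smul]
    congr 3
    abel

theorem homPart_yMap_mul (g : U ⊕ F → ℤ) (p : QTorus (yForm b d)) (z : LP t) :
    homPart t τ g (h.yMap p * z) = h.yMap p * homPart t τ g z := by
  classical
  induction p using QTorus.induction with
  | h0 => simp
  | hadd p p' hp hp' => rw [map_add, add_mul, map_add, hp, hp', add_mul]
  | hX a n =>
  induction z using QTorus.induction with
  | h0 => simp
  | hadd z w hz hw => rw [mul_add, map_add, hz, hw, map_add, mul_add]
  | hX a' m =>
    have h1 : (∃ k, yExp t τ n + m = g + yExp t τ k) ↔ ∃ k, m = g + yExp t τ k := by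
      constructor
      · rintro ⟨k, hk⟩
        exact ⟨k - n, by rw [map_sub, ← add_sub_assoc, ← hk, add_sub_cancel_left]⟩
      · rintro ⟨k, rfl⟩
        exact ⟨k + n, by rw [map_add, add_comm, add_assoc]⟩
    simp only [map_smul, h.yMap_X, QTorus.smul_mul, QTorus.mul_smul, QTorus.X_mul_X, homPart_X, h1]
    split_ifs
    · rw [QTorus.X_mul_X]
    · simp

open Classical in
/-- Homogeneous components can be read off from an expansion in `Frac t` with coefficients in the
fractions of the torus of `Y`-monomials. -/
theorem toFrac_homPart (g : U ⊕ F → ℤ) {ι : Type*} (S : Finset ι) (r : ι → FracTorus (yForm b d))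
    (e : ι → U ⊕ F → ℤ) (z : LP t)
    (hz : toFrac t.Λ z = ∑ i ∈ S, h.yFrac (r i) * toFrac t.Λ (QTorus.X t.Λ (e i))) :
    toFrac t.Λ (homPart t τ g z) = ∑ i ∈ S, if ∃ n, e i = g + yExp t τ n then
      h.yFrac (r i) * toFrac t.Λ (QTorus.X t.Λ (e i)) else 0 := by
  -- Multiplication by a common denominator turns the expansion into one in `LP(t)`.
  obtain ⟨s, p, hs, hp⟩ := exists_common_denominator S r
  have hp' : ∀ i ∈ S, toFrac t.Λ (h.yMap s) * h.yFrac (r i) = toFrac t.Λ (h.yMap (p i)) := by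
    intro i hi
    rw [← h.yFrac_toFrac, ← map_mul, hp i hi, h.yFrac_toFrac]
  have h1 : h.yMap s * z = ∑ i ∈ S, h.yMap (p i) * QTorus.X t.Λ (e i) := by
    apply toFrac_injective
    rw [map_mul, hz, Finset.mul_sum, map_sum]
    refine Finset.sum_congr rfl fun i hi => ?_
    rw [← mul_assoc, hp' i hi, map_mul]
  have hs0 : toFrac t.Λ (h.yMap s) ≠ 0 :=
    toFrac_ne_zero ((map_ne_zero_iff _ h.yMap_injective).2 hs)
  apply mul_left_cancel₀ hs0
  rw [← map_mul, ← h.homPart_yMap_mul, h1, map_sum, map_sum, Finset.mul_sum]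
  refine Finset.sum_congr rfl fun i hi => ?_
  rw [h.homPart_yMap_mul, homPart_X]
  split_ifs
  · rw [← mul_assoc, hp' i hi, map_mul]
  · simp

end HasPrincipalPart

end Homogeneous

/-! ### Transfer between similar seeds -/

section Transfer

variable {U F : Type*} [Fintype U] [Fintype F] [DecidableEq U] [DecidableEq F]
variable {b : Matrix U U ℤ} {d : U → ℤ} {τ : Equiv.Perm U} {t : QuantumSeed U F}

namespace PatternSeed

/-- The part of `LP(s)` in a given degree with unfrozen part `u`, for a seed `s` described by `a`:
the left coefficients of its elements. -/
def laurent (a : PatternSeed b d) (u : U → ℤ) : Submodule Base (FracTorus (yForm b d)) :=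
  Submodule.span Base {x | ∃ v n, a.deg v = u + b *ᵥ n ∧ x = a.R v * toFrac _ (QTorus.X _ n)}

end PatternSeed

/-- Multiplication by `X^g` on the right, as a map from the fractions of the torus of
`Y`-monomials to `Frac t`. -/
def HasPrincipalPart.monomialMul (h : HasPrincipalPart b d τ t) (g : U ⊕ F → ℤ) :
    FracTorus (yForm b d) →ₗ[Base] Frac t :=
  (LinearMap.mulRight Base (toFrac t.Λ (QTorus.X t.Λ g))).comp h.yFrac.toLinearMap

namespace HasPrincipalPart

variable (h : HasPrincipalPart b d τ t)

theorem monomialMul_apply (g : U ⊕ F → ℤ) (x : FracTorus (yForm b d)) :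
    h.monomialMul g x = h.yFrac x * toFrac t.Λ (QTorus.X t.Λ g) := rfl

theorem toFrac_X_ne_zero (g : U ⊕ F → ℤ) : toFrac t.Λ (QTorus.X t.Λ g) ≠ 0 :=
  (isFrame_toFrac t).ne_zero g

theorem monomialMul_injective (g : U ⊕ F → ℤ) : Function.Injective (h.monomialMul g) :=
  fun _ _ hxy => h.yFrac.toRingHom.injective (mul_right_cancel₀ (toFrac_X_ne_zero g) hxy)

theorem toFrac_ser (g : U ⊕ F → ℤ) (c : (U → ℤ) →₀ Base) :
    toFrac t.Λ (ser t τ g c) =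
      h.monomialMul g (toFrac _ (leftCoeff b d (unfrozen F τ g) c)) := by
  rw [h.ser_eq_mul, map_mul, monomialMul_apply, h.yFrac_toFrac]

theorem monomialMul_add_yExp (g : U ⊕ F → ℤ) (n : U → ℤ) (x : FracTorus (yForm b d)) :
    h.monomialMul (g + yExp t τ n) x = qHalf (-form t.Λ (yExp t τ n) g) •
      h.monomialMul g (x * toFrac _ (QTorus.X _ n)) := by
  rw [monomialMul_apply, monomialMul_apply, map_mul, h.yFrac_toFrac, h.yMap_X, mul_assoc,
    ← map_mul, QTorus.X_mul_X, map_smul, mul_smul_comm, qHalf_smul_smul, neg_add_cancel,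
    qHalf_zero_smul, add_comm g]

end HasPrincipalPart

namespace PatternSeed.Describes

variable {h : HasPrincipalPart b d τ t} {a : PatternSeed b d} {s : SeedIn t}
  {γ : (U ⊕ F → ℤ) →+ (U ⊕ F → ℤ)} (ha : Describes h a s γ)
include ha

theorem X_eq_monomialMul (m : U ⊕ F → ℤ) :
    s.X m = h.monomialMul (γ m) (a.R (unfrozen F τ m)) := ha.X_eq m

open Classical in
/-- Expansion of the homogeneous components of an element of `LP(t) ∩ LP(s)`. -/
theorem exists_expansion {z : LP t} (hz : toFrac t.Λ z ∈ s.laurent) (g : U ⊕ F → ℤ) :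
    ∃ (S : Finset (U ⊕ F → ℤ)) (x : (U ⊕ F → ℤ) → Base),
      toFrac t.Λ (homPart t τ g z) =
        ∑ m ∈ S, if ∃ n, γ m = g + yExp t τ n then x m • s.X m else 0 := by
  obtain ⟨x, hx⟩ := (Finsupp.mem_span_range_iff_exists_finsupp).1 hz
  refine ⟨x.support, x, ?_⟩
  have h1 : ∀ m, x m • s.X m = h.yFrac (x m • a.R (unfrozen F τ m)) *
      toFrac t.Λ (QTorus.X t.Λ (γ m)) := by
    intro m
    rw [ha.X_eq, map_smul, smul_mul_assoc]
  simp only [h1]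
  refine h.toFrac_homPart g x.support _ _ z ?_
  rw [← hx]
  exact Finset.sum_congr rfl fun m _ => h1 m

theorem homPart_mem {z : LP t} (hz : toFrac t.Λ z ∈ s.laurent) (g : U ⊕ F → ℤ) :
    toFrac t.Λ (homPart t τ g z) ∈ s.laurent := by
  obtain ⟨S, x, hx⟩ := ha.exists_expansion hz g
  rw [hx]
  refine sum_mem fun m _ => ?_
  split_ifs
  · exact Submodule.smul_mem _ _ (Submodule.subset_span ⟨m, rfl⟩)
  · exact zero_mem _

/-- Whether a homogeneous element of `LP(t)` lies in `LP(s)` depends on its left coefficient and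
the unfrozen part of its degree only. -/
theorem toFrac_ser_mem_iff (g : U ⊕ F → ℤ) (c : (U → ℤ) →₀ Base) :
    toFrac t.Λ (ser t τ g c) ∈ s.laurent ↔
      toFrac _ (leftCoeff b d (unfrozen F τ g) c) ∈ a.laurent (unfrozen F τ g) := by
  constructor
  · intro hc
    obtain ⟨S, x, hx⟩ := ha.exists_expansion hc g
    rw [homPart_self, h.toFrac_ser] at hx
    suffices h1 : h.monomialMul g (toFrac _ (leftCoeff b d (unfrozen F τ g) c)) ∈
        (a.laurent (unfrozen F τ g)).map (h.monomialMul g) by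
      obtain ⟨y, hy, hyx⟩ := h1
      rwa [← h.monomialMul_injective g hyx]
    rw [hx]
    refine sum_mem fun m _ => ?_
    split_ifs with hm
    · obtain ⟨n, hn⟩ := hm
      refine Submodule.smul_mem _ _ ?_
      rw [ha.X_eq_monomialMul, hn, h.monomialMul_add_yExp]
      refine Submodule.smul_mem _ _ (Submodule.mem_map_of_mem (Submodule.subset_span
        ⟨_, n, ?_, rfl⟩))
      rw [← ha.deg_eq, hn, map_add, h.unfrozen_yExp]
    · exact zero_mem _
  · intro hc
    rw [h.toFrac_ser]
    suffices h1 : a.laurent (unfrozen F τ g) ≤ s.laurent.comap (h.monomialMul g) from h1 hc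
    rw [PatternSeed.laurent, Submodule.span_le]
    rintro _ ⟨v, n, hv, rfl⟩
    -- A Laurent monomial of `s` of degree `g + B n` is found by correcting frozen exponents.
    set m₀ : U ⊕ F → ℤ := Sum.elim (permute τ v) 0 with hm₀
    have hv₀ : unfrozen F τ m₀ = v := by
      ext i
      simp [unfrozen_apply, hm₀, permute]
    set w := g + yExp t τ n - γ m₀ with hw
    have hw₀ : unfrozen F τ w = 0 := by
      rw [hw, map_sub, map_add, h.unfrozen_yExp, ha.deg_eq, hv₀, hv, sub_self]
    have hγ : γ (m₀ + w) = g + yExp t τ n := by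
      rw [map_add, ha.frozen w hw₀, hw, add_sub_cancel]
    have h2 := ha.X_eq_monomialMul (m₀ + w)
    rw [hγ, map_add, hv₀, hw₀, add_zero, h.monomialMul_add_yExp] at h2
    change h.monomialMul g _ ∈ s.laurent
    have h3 : s.X (m₀ + w) ∈ s.laurent := Submodule.subset_span ⟨_, rfl⟩
    rw [h2] at h3
    have h4 := Submodule.smul_mem _ (qHalf (form t.Λ (yExp t τ n) g)) h3
    rwa [qHalf_smul_smul, add_neg_cancel, qHalf_zero_smul] at h4

end PatternSeed.Describes

namespace HasPrincipalPart

variable (h : HasPrincipalPart b d τ t)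
include h

theorem homPart_mem_upperClusterAlgebra {z : LP t} (hz : z ∈ upperClusterAlgebra t)
    (g : U ⊕ F → ℤ) : homPart t τ g z ∈ upperClusterAlgebra t := by
  intro s hs
  obtain ⟨a, γ, -, ha⟩ := PatternSeed.exists_describes_of_reachable (h := h) hs
  exact ha.homPart_mem (hz s hs) g

theorem ser_mem_upperClusterAlgebra_iff (g : U ⊕ F → ℤ) (c : (U → ℤ) →₀ Base) :
    ser t τ g c ∈ upperClusterAlgebra t ↔ ∀ a : PatternSeed b d, PatternSeed.Reachable b d a →
      toFrac _ (leftCoeff b d (unfrozen F τ g) c) ∈ a.laurent (unfrozen F τ g) := by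
  constructor
  · intro hc a ha
    obtain ⟨s, γ, hs, hd⟩ := ha.exists_describes h
    exact (hd.toFrac_ser_mem_iff g c).1 (hc s hs)
  · intro hc s hs
    obtain ⟨a, γ, ha, hd⟩ := PatternSeed.exists_describes_of_reachable (h := h) hs
    exact (hd.toFrac_ser_mem_iff g c).2 (hc a ha)

end HasPrincipalPart

variable {F' : Type*} [Fintype F'] [DecidableEq F'] {τ' : Equiv.Perm U} {t' : QuantumSeed U F'}

/-- Membership of a homogeneous element in the upper cluster algebra does not depend on the frozen
variables. -/
theorem ser_mem_upperClusterAlgebra_transfer (h : HasPrincipalPart b d τ t)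
    (h' : HasPrincipalPart b d τ' t') {g : U ⊕ F → ℤ} {g' : U ⊕ F' → ℤ}
    (hg : unfrozen F τ g = unfrozen F' τ' g') {c : (U → ℤ) →₀ Base}
    (hc : ser t τ g c ∈ upperClusterAlgebra t) : ser t' τ' g' c ∈ upperClusterAlgebra t' := by
  rw [h'.ser_mem_upperClusterAlgebra_iff, ← hg]
  exact (h.ser_mem_upperClusterAlgebra_iff g c).1 hc

/-- The expansion of a Laurent monomial of a seed does not depend on the frozen variables. -/
theorem PatternSeed.Describes.toFrac_ser_eq_X {h : HasPrincipalPart b d τ t}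
    {h' : HasPrincipalPart b d τ' t'} {a : PatternSeed b d} {s : SeedIn t} {s' : SeedIn t'}
    {γ : (U ⊕ F → ℤ) →+ (U ⊕ F → ℤ)} {γ' : (U ⊕ F' → ℤ) →+ (U ⊕ F' → ℤ)}
    (ha : a.Describes h s γ) (ha' : a.Describes h' s' γ') {m : U ⊕ F → ℤ} {m' : U ⊕ F' → ℤ}
    (hm : unfrozen F τ m = unfrozen F' τ' m') {g : U ⊕ F → ℤ} {c : (U → ℤ) →₀ Base}
    (hc : toFrac t.Λ (ser t τ g c) = s.X m) :
    ∃ g' : U ⊕ F' → ℤ, unfrozen F' τ' g' = unfrozen F τ g ∧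
      toFrac t'.Λ (ser t' τ' g' c) = s'.X m' := by
  classical
  have h1 := h.toFrac_homPart (γ m) {m} (fun m => a.R (unfrozen F τ m)) γ (ser t τ g c) (by
    rw [Finset.sum_singleton, hc, ha.X_eq])
  have h2 : s.X m ≠ 0 := ha.compat.frame.ne_zero m
  -- A nonzero element has only one degree, so `g` and `γ m` differ by the degree of some `Yⁿ`.
  obtain ⟨n, rfl⟩ : ∃ n, g = γ m + yExp t τ n := by
    by_contra hn
    rw [homPart_ser, if_neg hn, map_zero, Finset.sum_singleton, if_pos ⟨0, by simp⟩,
      ← ha.X_eq] at h1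
    exact h2 h1.symm
  refine ⟨γ' m' + yExp t' τ' n, ?_, ?_⟩
  · rw [map_add, map_add, h.unfrozen_yExp, h'.unfrozen_yExp, ha.deg_eq, ha'.deg_eq, hm]
  · rw [ser_add_yExp, h.toFrac_ser, ha.X_eq_monomialMul] at hc
    rw [ser_add_yExp, h'.toFrac_ser, ha'.X_eq_monomialMul, ha'.deg_eq, ← hm, ← ha.deg_eq,
      h.monomialMul_injective _ hc]

end Transfer

/-! ### Pointed elements -/

section Pointed

variable {U F : Type*} [Fintype U] [Fintype F] [DecidableEq U] [DecidableEq F]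

/-- The inclusion of families indexed by `ℕ^U` into families indexed by `ℤ^U`. -/
def castFamily {U : Type*} (c : (U → ℕ) →₀ Base) : (U → ℤ) →₀ Base :=
  c.mapDomain fun n k => (n k : ℤ)

theorem natCast_vec_injective {U : Type*} :
    Function.Injective fun (n : U → ℕ) (k : U) => (n k : ℤ) :=
  fun _ _ h => funext fun k => Int.ofNat_injective (congrFun h k)

theorem fSeries_mapDomain_permute (t : QuantumSeed U F) (τ : Equiv.Perm U) (g : U ⊕ F → ℤ)
    (c : (U → ℕ) →₀ Base) :
    fSeries t g (c.mapDomain (permute τ)) = ser t τ g (castFamily c) := by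
  rw [fSeries, castFamily, ser, Finsupp.linearCombination_mapDomain,
    Finsupp.linearCombination_apply, Finsupp.sum_mapDomain_index (by simp)
    (by intros; rw [add_smul])]
  rfl

theorem fSeries_eq_ser (t : QuantumSeed U F) (g : U ⊕ F → ℤ) (c : (U → ℕ) →₀ Base) :
    fSeries t g c = ser t 1 g (castFamily c) := by
  rw [← fSeries_mapDomain_permute]
  congr 1
  exact Finsupp.mapDomain_id.symm

theorem mapDomain_permute_zero (τ : Equiv.Perm U) (c : (U → ℕ) →₀ Base) :
    c.mapDomain (permute τ) 0 = c 0 := by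
  have h : Function.Injective (permute τ : (U → ℕ) → (U → ℕ)) := by
    intro n n' hn
    ext k
    simpa [permute] using congrFun hn (τ k)
  exact Finsupp.mapDomain_apply h c 0

theorem isPointed_ser (t : QuantumSeed U F) (τ : Equiv.Perm U) (g : U ⊕ F → ℤ)
    {c : (U → ℕ) →₀ Base} (hc : c 0 = 1) : IsPointed t g (ser t τ g (castFamily c)) :=
  ⟨c.mapDomain (permute τ), by rw [mapDomain_permute_zero, hc],
    (fSeries_mapDomain_permute t τ g c).symm⟩

variable {t : QuantumSeed U F}

/-- The linear form `v ↦ Λ(v, ∑ₖ f_k)`, which is positive on the exponents of the `Y`-variables. -/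
def weight (t : QuantumSeed U F) (v : U ⊕ F → ℤ) : ℤ := form t.Λ v (Sum.elim 1 0)

theorem weight_add_mulVec (g : U ⊕ F → ℤ) (n : U → ℤ) :
    weight t (g + t.B *ᵥ n) = weight t g + ∑ k, t.d k * n k := by
  rw [weight, form_add_left, form_mulVec_left]
  simp [weight]

theorem weight_lt {n : U → ℕ} (hn : n ≠ 0) (g : U ⊕ F → ℤ) :
    weight t g < weight t (g + t.B *ᵥ fun k => (n k : ℤ)) := by
  rw [weight_add_mulVec, lt_add_iff_pos_right]
  obtain ⟨k, hk⟩ := Function.ne_iff.1 hn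
  refine Finset.sum_pos' (fun j _ => mul_nonneg (t.d_pos j).le (Int.natCast_nonneg _))
    ⟨k, Finset.mem_univ k, mul_pos (t.d_pos k) ?_⟩
  exact_mod_cast Nat.pos_of_ne_zero hk

theorem Dominated.weight_lt {g' g : U ⊕ F → ℤ} (h : Dominated t g' g) :
    weight t g < weight t g' := by
  obtain ⟨n, hn, rfl⟩ := h
  exact QuantumCluster.weight_lt hn g

theorem coeff_fSeries (g m : U ⊕ F → ℤ) (c : (U → ℕ) →₀ Base) :
    QTorus.coeff m (fSeries t g c) =
      c.sum fun n a => if (g + t.B *ᵥ fun k => (n k : ℤ)) = m then a else 0 := by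
  rw [fSeries, Finsupp.sum, map_sum]
  refine Finset.sum_congr rfl fun n _ => ?_
  rw [map_smul, QTorus.coeff_X]
  by_cases h : (g + t.B *ᵥ fun k => (n k : ℤ)) = m
  · simp [if_pos h]
  · simp [if_neg h]

theorem IsPointed.eq_or_weight_lt {g m : U ⊕ F → ℤ} {z : LP t} (hz : IsPointed t g z)
    (hm : QTorus.coeff m z ≠ 0) : m = g ∨ weight t g < weight t m := by
  obtain ⟨c, -, rfl⟩ := hz
  rw [coeff_fSeries] at hm
  obtain ⟨n, -, hn⟩ := Finset.exists_ne_zero_of_sum_ne_zero hm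
  have h1 : g + (t.B *ᵥ fun k => (n k : ℤ)) = m := by
    by_contra h
    exact hn (if_neg h)
  rcases eq_or_ne n 0 with rfl | h0
  · left
    rw [← h1]
    have : (fun k : U => (((0 : U → ℕ) k : ℕ) : ℤ)) = 0 := by ext; simp
    rw [this, Matrix.mulVec_zero, add_zero]
  · right
    rw [← h1]
    exact weight_lt h0 g

theorem IsPointed.coeff_self {g : U ⊕ F → ℤ} {z : LP t} (hz : IsPointed t g z) :
    QTorus.coeff g z = 1 := by
  obtain ⟨c, hc, rfl⟩ := hz
  rw [coeff_fSeries, Finsupp.sum, Finset.sum_eq_single 0]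
  · have : (fun k : U => (((0 : U → ℕ) k : ℕ) : ℤ)) = 0 := by ext; simp
    rw [this, Matrix.mulVec_zero, add_zero, if_pos rfl, hc]
  · intro n _ hn
    refine if_neg fun h => ?_
    have := weight_lt (t := t) hn g
    rw [h] at this
    exact lt_irrefl _ this
  · intro h0
    rw [Finsupp.notMem_support_iff.1 h0]
    simp

theorem IsPointed.degree_unique {g g' : U ⊕ F → ℤ} {z : LP t} (hz : IsPointed t g z)
    (hz' : IsPointed t g' z) : g = g' := by
  rcases hz.eq_or_weight_lt (m := g') (by rw [hz'.coeff_self]; exact one_ne_zero) with h | h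
  · exact h.symm
  rcases hz'.eq_or_weight_lt (m := g) (by rw [hz.coeff_self]; exact one_ne_zero) with h' | h'
  · exact h'
  · exact absurd h (lt_asymm h')

/-- The coefficient matrix of a pointed family is unitriangular for `weight`. -/
theorem linearIndependent_of_isPointed {L : (U ⊕ F → ℤ) → LP t}
    (hL : ∀ g, IsPointed t g (L g)) : LinearIndependent Base L := by
  classical
  rw [linearIndependent_iff']
  intro S a ha
  by_contra! hne
  obtain ⟨g₀, hg₀, hag₀⟩ := hne
  -- The coefficient of `X^g` singles out `a g` when `g` has minimal weight.
  obtain ⟨g, hg, hmin⟩ := Finset.exists_min_image (S.filter fun g => a g ≠ 0) (weight t)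
    ⟨g₀, Finset.mem_filter.2 ⟨hg₀, hag₀⟩⟩
  rw [Finset.mem_filter] at hg
  have h1 := congrArg (QTorus.coeff g) ha
  rw [map_sum, map_zero, Finset.sum_eq_single g] at h1
  · rw [map_smul, (hL g).coeff_self, smul_eq_mul, mul_one] at h1
    exact hg.2 h1
  · intro g' hg' hgg'
    rw [map_smul, smul_eq_mul]
    by_contra h2
    have h3 := hmin g' (Finset.mem_filter.2 ⟨hg', left_ne_zero_of_mul h2⟩)
    rcases (hL g').eq_or_weight_lt (right_ne_zero_of_mul h2) with h4 | h4
    · exact hgg' h4.symm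
    · exact absurd h4 (not_lt.2 h3)
  · exact fun h => absurd hg.1 h

theorem IsPointed.add_smul {g g' : U ⊕ F → ℤ} {z y : LP t} (hz : IsPointed t g z)
    (hy : IsPointed t g' y) (hg : Dominated t g' g) (a : Base) : IsPointed t g (z + a • y) := by
  obtain ⟨c, hc, rfl⟩ := hz
  obtain ⟨c', -, rfl⟩ := hy
  obtain ⟨n, hn, rfl⟩ := hg
  refine ⟨c + a • c'.mapDomain (n + ·), ?_, ?_⟩
  · rw [Finsupp.add_apply, hc, Finsupp.smul_apply, Finsupp.mapDomain_of_notMem_range, smul_zero,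
      add_zero]
    rintro ⟨m, hm⟩
    exact hn (funext fun k => (Nat.add_eq_zero_iff.1 (congrFun hm k)).1)
  · have h1 : castFamily (c + a • c'.mapDomain (n + ·)) =
        castFamily c + a • (castFamily c').mapDomain ((fun k => (n k : ℤ)) + ·) := by
      rw [castFamily, Finsupp.mapDomain_add, Finsupp.mapDomain_smul, castFamily, castFamily,
        ← Finsupp.mapDomain_comp, ← Finsupp.mapDomain_comp]
      congr 3
    have h2 : (t.B *ᵥ fun k => (n k : ℤ)) = yExp t 1 fun k => (n k : ℤ) := rfl
    rw [fSeries_eq_ser, fSeries_eq_ser, fSeries_eq_ser, h1, map_add, map_smul, h2, ser_add_yExp]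

theorem IsPointed.add_sum {L : (U ⊕ F → ℤ) → LP t} (hL : ∀ g, IsPointed t g (L g))
    {g : U ⊕ F → ℤ} {z : LP t} (hz : IsPointed t g z) (S : Finset (U ⊕ F → ℤ))
    (hS : ∀ g' ∈ S, Dominated t g' g) (a : (U ⊕ F → ℤ) → Base) :
    IsPointed t g (z + ∑ g' ∈ S, a g' • L g') := by
  classical
  induction S using Finset.induction_on with
  | empty => simpa using hz
  | insert g' S hg' ih =>
    rw [Finset.sum_insert hg', add_comm (_ • _), ← add_assoc]
    exact (ih fun g h => hS g (Finset.mem_insert_of_mem h)).add_smul (hL g')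
      (hS g' (Finset.mem_insert_self g' S)) _

end Pointed

/-! ### The bar involution -/

section Bar

theorem QTorus.coeff_bar {I : Type*} [Fintype I] {Λ : Matrix I I ℤ} (m : I → ℤ) (z : QTorus Λ) :
    QTorus.coeff m z.bar = LaurentPolynomial.invert (QTorus.coeff m z) := by
  simp [QTorus.coeff, QTorus.bar]

theorem QTorus.bar_add {I : Type*} [Fintype I] {Λ : Matrix I I ℤ} (z w : QTorus Λ) :
    (z + w).bar = z.bar + w.bar :=
  QTorus.coeff_ext fun m => by simp only [QTorus.coeff_bar, map_add]

theorem QTorus.bar_smul {I : Type*} [Fintype I] {Λ : Matrix I I ℤ} (a : Base) (z : QTorus Λ) :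
    (a • z).bar = LaurentPolynomial.invert a • z.bar :=
  QTorus.coeff_ext fun m => by simp only [QTorus.coeff_bar, map_smul, smul_eq_mul, map_mul]

theorem QTorus.bar_X {I : Type*} [Fintype I] {Λ : Matrix I I ℤ} (m : I → ℤ) :
    (QTorus.X Λ m).bar = QTorus.X Λ m := by
  classical
  refine QTorus.coeff_ext fun n => ?_
  rw [QTorus.coeff_bar, QTorus.coeff_X]
  split_ifs <;> simp

theorem QTorus.bar_zero {I : Type*} [Fintype I] {Λ : Matrix I I ℤ} : (0 : QTorus Λ).bar = 0 :=
  QTorus.coeff_ext fun m => by simp only [QTorus.coeff_bar, map_zero]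

theorem bar_ser {U F : Type*} [Fintype U] [Fintype F] [DecidableEq U]
    [DecidableEq F] (t : QuantumSeed U F) (τ : Equiv.Perm U) (g : U ⊕ F → ℤ) (c : (U → ℤ) →₀ Base) :
    (ser t τ g c).bar =
      ser t τ g (c.mapRange (LaurentPolynomial.invert (R := ℤ)) (map_zero _)) := by
  induction c using Finsupp.induction_linear with
  | zero => simp [QTorus.bar_zero]
  | add c c' hc hc' =>
    rw [map_add, QTorus.bar_add, hc, hc', Finsupp.mapRange_add (map_add _), map_add]
  | single n a =>
    rw [ser_single, QTorus.bar_smul, QTorus.bar_X, Finsupp.mapRange_single, ser_single]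

/-- No nonzero bar-invariant scalar has only negative powers of `q^{1/2}`. -/
theorem eq_zero_of_mem_maxIdeal {a : Base} (ha : a ∈ maxIdeal)
    (hbar : LaurentPolynomial.invert a = a) : a = 0 := by
  ext i
  by_contra hi
  have h1 := ha i hi
  have h2 := ha (-i) (by rwa [← LaurentPolynomial.invert_apply, hbar])
  omega

end Bar

/-! ### Coefficients of a triangular basis -/

section Coefficients

variable {U F : Type*} [Fintype U] [Fintype F] [DecidableEq U] [DecidableEq F]

theorem twist_zero (d : U → ℤ) (c : (U → ℤ) →₀ Base) : twist d 0 c = c := by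
  induction c using Finsupp.induction_linear with
  | zero => simp
  | add c c' hc hc' => rw [map_add, hc, hc']
  | single n a => rw [twist_single]; simp

variable {b : Matrix U U ℤ} {d : U → ℤ} {τ : Equiv.Perm U} {t : QuantumSeed U F}

/-- Bar-invariance of a basis element together with the triangularity of its product with a frozen
variable leaves no room for correction terms. -/
theorem IsTriangularBasis.add_frozen (h : HasPrincipalPart b d τ t) {L : (U ⊕ F → ℤ) → LP t}
    (hL : IsTriangularBasis t L) {C : (U ⊕ F → ℤ) → (U → ℤ) →₀ Base}
    (hC : ∀ g, L g = ser t τ g (C g)) (hp : ∀ g g', IsPointed t g' (ser t τ g' (C g))) (j : F)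
    (g : U ⊕ F → ℤ) : C (g + f (Sum.inr j)) = C g := by
  obtain ⟨x, hx, -, α, hα⟩ := hL.triangular (Sum.inr j) g
  have hj : unfrozen F τ (f (Sum.inr j)) = 0 := by
    ext i
    simp [unfrozen_apply]
  rw [hC g, h.X_mul_ser, hj, twist_zero] at hα
  set z := ser t τ (g + f (Sum.inr j)) (C g) with hz
  have hpz : IsPointed t (g + f (Sum.inr j)) z := hp _ _
  have hpy := (hL.pointed (g + f (Sum.inr j))).add_sum hL.pointed x.support
    (fun g' hg' => (hx g' hg').1) x
  -- Both sides are multiples of pointed elements, so the leading coefficients fix the power of `q`.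
  have h1 := congrArg (QTorus.coeff (g + f (Sum.inr j))) hα
  rw [map_smul, map_smul, hpz.coeff_self, Finsupp.sum, hpy.coeff_self, smul_eq_mul, smul_eq_mul,
    mul_one, mul_one] at h1
  rw [qHalf_injective h1, qHalf_smul_inj] at hα
  have hbar : z.bar = z := by
    have h2 := hL.bar_eq g
    rw [hC g, bar_ser] at h2
    rw [hz, bar_ser, h.ser_injective g h2]
  -- The correction terms form a bar-invariant sum, so each of their coefficients is bar-invariant.
  have hbarsum : ∀ S : Finset (U ⊕ F → ℤ), (∑ g' ∈ S, x g' • L g').bar =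
      ∑ g' ∈ S, LaurentPolynomial.invert (x g') • L g' := by
    intro S
    induction S using Finset.induction_on with
    | empty => exact QTorus.bar_zero
    | insert g' S hg' ih =>
      rw [Finset.sum_insert hg', Finset.sum_insert hg', QTorus.bar_add, QTorus.bar_smul, ih,
        hL.bar_eq]
  have h3 : ∑ g' ∈ x.support, x g' • L g' =
      ∑ g' ∈ x.support, LaurentPolynomial.invert (x g') • L g' := by
    have h4 := congrArg QTorus.bar hα
    rw [hbar, hα, QTorus.bar_add, hL.bar_eq, Finsupp.sum, hbarsum] at h4
    exact add_left_cancel h4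
  have h5 : x.support = ∅ := by
    rw [Finset.eq_empty_iff_forall_notMem]
    intro g' hg'
    rw [← sub_eq_zero, ← Finset.sum_sub_distrib] at h3
    simp only [← sub_smul] at h3
    have h6 := linearIndependent_iff'.1 hL.linearIndependent x.support _ h3 g' hg'
    exact (Finsupp.mem_support_iff.1 hg')
      (eq_zero_of_mem_maxIdeal (hx g' hg').2 (sub_eq_zero.1 h6).symm)
  rw [Finsupp.sum, h5, Finset.sum_empty, add_zero, hC] at hα
  exact (h.ser_injective _ hα).symm

/-- The coefficients of the elements of a triangular basis depend on the unfrozen parts of their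
degrees only. -/
theorem IsTriangularBasis.exists_coefficients (h : HasPrincipalPart b d 1 t)
    {L : (U ⊕ F → ℤ) → LP t} (hL : IsTriangularBasis t L) :
    ∃ D : (U → ℤ) → (U → ℕ) →₀ Base, (∀ u, D u 0 = 1) ∧
      ∀ g, L g = ser t 1 g (castFamily (D (unfrozen F 1 g))) := by
  choose C hC0 hC using hL.pointed
  -- Translation-invariance of the coefficients along the frozen unit vectors extends to the group
  -- that they generate.
  have hC' : ∀ g, L g = ser t 1 g (castFamily (C g)) := fun g => by rw [hC g, fSeries_eq_ser]
  have hadd : ∀ w, unfrozen F 1 w = 0 → ∀ g, castFamily (C (g + w)) = castFamily (C g) := by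
    intro w hw
    let H : AddSubgroup (U ⊕ F → ℤ) :=
      { carrier := {w | ∀ g, castFamily (C (g + w)) = castFamily (C g)}
        zero_mem' := fun g => by rw [add_zero]
        add_mem' := fun {v w} hv hw g => by rw [← add_assoc, hw, hv]
        neg_mem' := fun {w} hw g => by rw [← hw (g + -w), neg_add_cancel_right] }
    suffices hwH : w ∈ H from hwH
    have hsum : w = ∑ j : F, w (Sum.inr j) • f (Sum.inr j) := by
      conv_lhs => rw [pi_eq_sum_univ' w, Fintype.sum_sum_type]
      have h0 : ∀ i : U, w (Sum.inl i) = 0 := fun i => congrFun hw i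
      simp only [h0, zero_smul, Finset.sum_const_zero, zero_add]
    rw [hsum]
    refine sum_mem fun j _ => zsmul_mem (K := H) ?_ _
    exact hL.add_frozen (C := fun g => castFamily (C g)) h hC'
      (fun g g' => isPointed_ser t 1 g' (hC0 g)) j
  refine ⟨fun u => C (extend u), fun u => hC0 _, fun g => ?_⟩
  have h1 : unfrozen F 1 (g - extend (unfrozen F 1 g)) = 0 := by
    ext i
    simp [unfrozen_apply, extend]
  have h2 := hadd _ h1 (extend (unfrozen F 1 g))
  rw [add_sub_cancel] at h2
  rw [hC', h2]

end Coefficients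

/-! ### Construction of the transferred basis -/

section Construction

variable {U F F' : Type*} [Fintype U] [Fintype F] [Fintype F']
  [DecidableEq U] [DecidableEq F] [DecidableEq F']
variable {b : Matrix U U ℤ} {d : U → ℤ} {τ : Equiv.Perm U}

theorem unfrozen_extend (u : U → ℤ) : unfrozen F τ (extend (permute τ u)) = u := by
  ext i
  simp [unfrozen_apply, extend, permute]

theorem unfrozen_one_extend (u : U → ℤ) : unfrozen F 1 (extend u) = u := rfl

/-- The family of pointed elements of `LP(t)` whose coefficients are prescribed by the unfrozen
parts of their degrees. -/
def pointedFamily (t : QuantumSeed U F) (τ : Equiv.Perm U) (D : (U → ℤ) → (U → ℕ) →₀ Base)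
    (g : U ⊕ F → ℤ) : LP t :=
  ser t τ g (castFamily (D (unfrozen F τ g)))

variable {t : QuantumSeed U F} {t' : QuantumSeed U F'}
variable {D : (U → ℤ) → (U → ℕ) →₀ Base}

theorem pointedFamily_isPointed (hD : ∀ u, D u 0 = 1) (g : U ⊕ F → ℤ) :
    IsPointed t g (pointedFamily t τ D g) :=
  isPointed_ser t τ g (hD _)

theorem HasPrincipalPart.pointedFamily_add_yExp (h : HasPrincipalPart b d τ t)
    (g : U ⊕ F → ℤ) (n : U → ℤ) :
    pointedFamily t τ D (g + yExp t τ n) = ser t τ g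
      ((castFamily (D (unfrozen F τ g + b *ᵥ n))).mapDomain (n + ·)) := by
  rw [pointedFamily, ser_add_yExp, map_add, h.unfrozen_yExp]

/-- The coefficient families of the elements in the span of a pointed family which are homogeneous
of a degree with unfrozen part `u`. -/
def coefficientSpan (b : Matrix U U ℤ) (D : (U → ℤ) → (U → ℕ) →₀ Base) (u : U → ℤ) :
    Submodule Base ((U → ℤ) →₀ Base) :=
  Submodule.span Base
    (Set.range fun n => (castFamily (D (u + b *ᵥ n))).mapDomain (n + ·))

/-- Whether a homogeneous element is in the span of a pointed family depends on its coefficients and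
the unfrozen part of its degree only. -/
theorem HasPrincipalPart.ser_mem_span_iff (h : HasPrincipalPart b d τ t) (g : U ⊕ F → ℤ)
    (c : (U → ℤ) →₀ Base) :
    ser t τ g c ∈ Submodule.span Base (Set.range (pointedFamily t τ D)) ↔
      c ∈ coefficientSpan b D (unfrozen F τ g) := by
  classical
  constructor
  · intro hc
    obtain ⟨x, hx⟩ := (Finsupp.mem_span_range_iff_exists_finsupp).1 hc
    suffices h1 : ser t τ g c ∈
        (coefficientSpan b D (unfrozen F τ g)).map (ser t τ g) by
      obtain ⟨y, hy, hyc⟩ := h1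
      rwa [← h.ser_injective g hyc]
    rw [← homPart_self, ← hx, Finsupp.sum, map_sum]
    refine sum_mem fun k _ => ?_
    rw [map_smul, pointedFamily, homPart_ser]
    refine Submodule.smul_mem _ _ ?_
    split_ifs with hk
    · obtain ⟨n, rfl⟩ := hk
      have h2 := h.pointedFamily_add_yExp (D := D) g n
      rw [pointedFamily] at h2
      rw [h2]
      exact Submodule.mem_map_of_mem (Submodule.subset_span ⟨n, rfl⟩)
    · exact zero_mem _
  · intro hc
    suffices h1 : coefficientSpan b D (unfrozen F τ g) ≤
        (Submodule.span Base (Set.range (pointedFamily t τ D))).comap (ser t τ g) from h1 hc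
    rw [coefficientSpan, Submodule.span_le]
    rintro _ ⟨n, rfl⟩
    change ser t τ g _ ∈ Submodule.span Base (Set.range (pointedFamily t τ D))
    rw [← h.pointedFamily_add_yExp]
    exact Submodule.subset_span ⟨_, rfl⟩

open Classical in
theorem coeff_homPart (g m : U ⊕ F → ℤ) (z : LP t) :
    QTorus.coeff m (homPart t τ g z) =
      if ∃ n, m = g + yExp t τ n then QTorus.coeff m z else 0 := by
  induction z using QTorus.induction with
  | h0 => simp
  | hadd z w hz hw =>
    rw [map_add, map_add, map_add, hz, hw]
    split_ifs <;> simp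
  | hX a k =>
    rw [map_smul, map_smul, map_smul, homPart_X]
    by_cases hk : ∃ n, k = g + yExp t τ n
    · rw [if_pos hk]
      by_cases hm : ∃ n, m = g + yExp t τ n
      · rw [if_pos hm]
      · rw [if_neg hm, QTorus.coeff_X, if_neg (fun e : k = m => hm (e ▸ hk)), smul_zero]
    · rw [if_neg hk, map_zero, smul_zero]
      by_cases hm : ∃ n, m = g + yExp t τ n
      · rw [if_pos hm, QTorus.coeff_X, if_neg (fun e : k = m => hk (e ▸ hm)), smul_zero]
      · rw [if_neg hm]

/-- A submodule stable under passing to homogeneous components is generated by its homogeneous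
elements. -/
theorem le_of_homPart {V W : Submodule Base (LP t)}
    (hV : ∀ z ∈ V, ∀ g, homPart t τ g z ∈ V) (hVW : ∀ g c, ser t τ g c ∈ V → ser t τ g c ∈ W) :
    V ≤ W := by
  classical
  suffices h : ∀ (N : ℕ) (z : LP t), ((QTorus.monomialBasis t.Λ).repr z).support.card = N →
      z ∈ V → z ∈ W from fun z hz => h _ z rfl hz
  intro N
  induction N using Nat.strong_induction_on with
  | _ N ih =>
    intro z hN hz
    by_cases hz0 : z = 0
    · rw [hz0]
      exact zero_mem _
    obtain ⟨g, hg⟩ := QTorus.support_nonempty hz0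
    have h1 := hV z hz g
    have h2 : homPart t τ g z ∈ W := by
      obtain ⟨c, hc⟩ := exists_homPart_eq_ser (τ := τ) g z
      rw [hc] at h1 ⊢
      exact hVW g c h1
    have hcoeff : ∀ m, (QTorus.monomialBasis t.Λ).repr (z - homPart t τ g z) m =
        QTorus.coeff m z - if ∃ n, m = g + yExp t τ n then QTorus.coeff m z else 0 := by
      intro m
      rw [← coeff_homPart, ← map_sub]
      rfl
    have h3 : z - homPart t τ g z ∈ W := by
      refine ih _ ?_ _ rfl (sub_mem hz h1)
      rw [← hN]
      refine Finset.card_lt_card ((Finset.ssubset_iff_of_subset fun m hm => ?_).2 ⟨g, hg, ?_⟩)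
      · rw [Finsupp.mem_support_iff] at hm ⊢
        intro h0
        apply hm
        rw [hcoeff]
        have h0' : QTorus.coeff m z = 0 := h0
        simp [h0']
      · rw [Finsupp.notMem_support_iff, hcoeff, if_pos ⟨0, by simp⟩, sub_self]
    rw [← sub_add_cancel z (homPart t τ g z)]
    exact add_mem h3 h2

/-- A pointed family spans the upper cluster algebra of `t'` if the family with the same coefficients
spans that of `t`: both sides are graded, and their homogeneous elements correspond. -/
theorem span_pointedFamily_transfer {τ' : Equiv.Perm U} (h : HasPrincipalPart b d τ t)
    (h' : HasPrincipalPart b d τ' t')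
    (hspan : Submodule.span Base (Set.range (pointedFamily t τ D)) = upperClusterAlgebra t) :
    Submodule.span Base (Set.range (pointedFamily t' τ' D)) = upperClusterAlgebra t' := by
  apply le_antisymm
  · rw [Submodule.span_le]
    rintro _ ⟨g', rfl⟩
    have hg : unfrozen F τ (extend (permute τ (unfrozen F' τ' g'))) = unfrozen F' τ' g' :=
      unfrozen_extend _
    have h1 : pointedFamily t τ D (extend (permute τ (unfrozen F' τ' g'))) ∈
        upperClusterAlgebra t := by
      rw [← hspan]
      exact Submodule.subset_span (Set.mem_range_self _)
    rw [pointedFamily, hg] at h1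
    exact ser_mem_upperClusterAlgebra_transfer h h' hg h1
  · refine le_of_homPart (τ := τ') (fun z hz g => h'.homPart_mem_upperClusterAlgebra hz g)
      fun g' c hc => ?_
    have hg : unfrozen F τ (extend (permute τ (unfrozen F' τ' g'))) = unfrozen F' τ' g' :=
      unfrozen_extend _
    have h1 := ser_mem_upperClusterAlgebra_transfer h' h hg.symm hc
    rw [← hspan, h.ser_mem_span_iff, hg] at h1
    exact h'.ser_mem_span_iff _ _ |>.2 h1

end Construction

/-! ### Transfer of the properties of a triangular basis -/

section TransferBasis

variable {U F F' : Type*} [Fintype U] [Fintype F] [Fintype F']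
  [DecidableEq U] [DecidableEq F] [DecidableEq F']
variable {b : Matrix U U ℤ} {d : U → ℤ} {τ τ' : Equiv.Perm U}
variable {t : QuantumSeed U F} {t' : QuantumSeed U F'} {D : (U → ℤ) → (U → ℕ) →₀ Base}

theorem pointedFamily_extend (u : U → ℤ) :
    pointedFamily t τ D (extend (permute τ u)) =
      ser t τ (extend (permute τ u)) (castFamily (D u)) := by
  rw [pointedFamily, unfrozen_extend]

theorem bar_pointedFamily_transfer (h : HasPrincipalPart b d τ t)
    (hbar : ∀ g, (pointedFamily t τ D g).bar = pointedFamily t τ D g) (g' : U ⊕ F' → ℤ) :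
    (pointedFamily t' τ' D g').bar = pointedFamily t' τ' D g' := by
  have h1 := hbar (extend (permute τ (unfrozen F' τ' g')))
  rw [pointedFamily_extend, bar_ser] at h1
  rw [pointedFamily, bar_ser, h.ser_injective _ h1]

theorem ser_single_zero (t : QuantumSeed U F) (τ : Equiv.Perm U) (g : U ⊕ F → ℤ) :
    ser t τ g (Finsupp.single 0 1) = QTorus.X t.Λ g := by
  rw [ser_single, map_zero, add_zero, one_smul]

theorem unfrozen_unit (τ : Equiv.Perm U) (k : U) :
    unfrozen F τ (f (Sum.inl (τ k))) = Pi.single k 1 := by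
  ext i
  simp [unfrozen_apply, Pi.single_apply]

theorem monomial_mem_pointedFamily_transfer (h : HasPrincipalPart b d τ t)
    (hD : ∀ u, D u 0 = 1)
    (hmon : ∀ m : U ⊕ F → ℕ, QTorus.X t.Λ (fun i => (m i : ℤ)) ∈ Set.range (pointedFamily t τ D))
    (m : U ⊕ F' → ℕ) :
    QTorus.X t'.Λ (fun i => (m i : ℤ)) ∈ Set.range (pointedFamily t' τ' D) := by
  set u : U → ℕ := fun i => m (Sum.inl (τ' i)) with hu
  obtain ⟨g, hg⟩ := hmon (Sum.elim (permute τ u) 0)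
  have he : (fun i => ((Sum.elim (permute τ u) 0 : U ⊕ F → ℕ) i : ℤ)) =
      extend (permute τ fun k => (u k : ℤ)) := by
    ext i
    rcases i with i | i <;> simp [extend, permute]
  rw [he] at hg
  have hpt : IsPointed t (extend (permute τ fun k => (u k : ℤ)))
      (QTorus.X t.Λ (extend (permute τ fun k => (u k : ℤ)))) := by
    rw [← ser_single_zero t τ]
    have := isPointed_ser t τ (extend (permute τ fun k => (u k : ℤ)))
      (c := Finsupp.single 0 1) Finsupp.single_eq_same
    rw [castFamily, Finsupp.mapDomain_single] at this
    exact this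
  have h1 := (hg ▸ pointedFamily_isPointed hD g : IsPointed t g _).degree_unique hpt
  rw [h1, pointedFamily_extend, ← ser_single_zero t τ] at hg
  refine ⟨fun i => (m i : ℤ), ?_⟩
  rw [pointedFamily, ← ser_single_zero t' τ', ← h.ser_injective _ hg]
  rfl

/-- The seed reached from `t'` by the sequence of mutations leading to a seed `t[1]` is a seed
`t'[1]`, since the two seeds are described by the same pattern seed. -/
theorem isShift_transfer (h : HasPrincipalPart b d τ t) (h' : HasPrincipalPart b d τ' t')
    {s : SeedIn t} (hs : IsShift t s) :
    ∃ s' : SeedIn t', IsShift t' s' ∧ ∃ (a : PatternSeed b d) (γ : (U ⊕ F → ℤ) →+ (U ⊕ F → ℤ))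
      (γ' : (U ⊕ F' → ℤ) →+ (U ⊕ F' → ℤ)), a.Describes h s γ ∧ a.Describes h' s' γ' := by
  obtain ⟨hr, σ, hσ⟩ := hs
  obtain ⟨a, γ, hra, ha⟩ := PatternSeed.exists_describes_of_reachable (h := h) hr
  obtain ⟨s', γ', hr', ha'⟩ := hra.exists_describes h'
  refine ⟨s', ⟨hr', (τ'.symm.trans τ).trans (σ.trans (τ.symm.trans τ')), fun k => ?_⟩,
    a, γ, γ', ha, ha'⟩
  obtain ⟨z, g, hz, ⟨c, hc, rfl⟩, hg⟩ := hσ (τ (τ'.symm k))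
  have hc' : (c.mapDomain (permute τ.symm)) 0 = 1 := by rw [mapDomain_permute_zero, hc]
  have hfs : fSeries t g c = ser t τ g (castFamily (c.mapDomain (permute τ.symm))) := by
    rw [← fSeries_mapDomain_permute, ← Finsupp.mapDomain_comp]
    congr 1
    convert Finsupp.mapDomain_id.symm
    ext n k
    simp [permute]
  rw [hfs] at hz
  have hm : unfrozen F τ (f (Sum.inl (σ (τ (τ'.symm k))))) =
      unfrozen F' τ' (f (Sum.inl (τ' (τ.symm (σ (τ (τ'.symm k))))))) := by
    ext i
    simp [unfrozen_apply, Pi.single_apply, Equiv.eq_symm_apply]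
  obtain ⟨g', hg', hX⟩ := ha.toFrac_ser_eq_X ha' hm hz
  refine ⟨_, g', hX, isPointed_ser t' τ' g' hc', fun i => ?_⟩
  have h1 := congrFun hg' (τ'.symm i)
  rw [unfrozen_apply, unfrozen_apply, τ'.apply_symm_apply, hg] at h1
  rw [h1]
  simp [Pi.single_apply]

theorem shift_monomial_mem_transfer (h : HasPrincipalPart b d τ t)
    (h' : HasPrincipalPart b d τ' t')
    (hshift : ∃ s : SeedIn t, IsShift t s ∧
      ∀ m : U ⊕ F → ℕ, ∃ g, incl t (pointedFamily t τ D g) = s.X fun i => (m i : ℤ)) :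
    ∃ s : SeedIn t', IsShift t' s ∧
      ∀ m : U ⊕ F' → ℕ, ∃ g, incl t' (pointedFamily t' τ' D g) = s.X fun i => (m i : ℤ) := by
  obtain ⟨s, hs, hmon⟩ := hshift
  obtain ⟨s', hs', a, γ, γ', ha, ha'⟩ := isShift_transfer h h' hs
  refine ⟨s', hs', fun m => ?_⟩
  obtain ⟨g, hg⟩ := hmon (Sum.elim (permute τ fun i => m (Sum.inl (τ' i))) 0)
  have hm : unfrozen F τ (fun i =>
      ((Sum.elim (permute τ fun i => m (Sum.inl (τ' i))) 0 : U ⊕ F → ℕ) i : ℤ)) =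
      unfrozen F' τ' fun i => (m i : ℤ) := by
    ext i
    simp [unfrozen_apply, permute]
  obtain ⟨g', hg', hX⟩ := ha.toFrac_ser_eq_X ha' hm hg
  refine ⟨g', ?_⟩
  rw [pointedFamily, hg']
  exact hX

/-- The linear combination, with coefficients `β n`, of the members of a pointed family of degrees
`g + B n`: its coefficients relative to `X^g`, where `u` is the unfrozen part of `g`. -/
def combination (b : Matrix U U ℤ) (D : (U → ℤ) → (U → ℕ) →₀ Base) (u : U → ℤ)
    (β : (U → ℕ) →₀ Base) : (U → ℤ) →₀ Base :=
  β.sum fun n a => a • (castFamily (D (u + b *ᵥ fun k => (n k : ℤ)))).mapDomain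
    ((fun k => (n k : ℤ)) + ·)

/-- The map `n ↦ g + B (τ n)` on `ℕ^U`. -/
def lowerDegree (t : QuantumSeed U F) (τ : Equiv.Perm U) (g : U ⊕ F → ℤ) (n : U → ℕ) :
    U ⊕ F → ℤ :=
  g + yExp t τ fun k => (n k : ℤ)

theorem HasPrincipalPart.lowerDegree_injective (h : HasPrincipalPart b d τ t) (g : U ⊕ F → ℤ) :
    Function.Injective (lowerDegree t τ g) := fun _ _ hn =>
  natCast_vec_injective (h.yExp_injective (add_left_cancel hn))

theorem dominated_iff (t : QuantumSeed U F) (τ : Equiv.Perm U) (g' g : U ⊕ F → ℤ) :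
    Dominated t g' g ↔ ∃ n : U → ℕ, n ≠ 0 ∧ g' = lowerDegree t τ g n := by
  constructor
  · rintro ⟨n, hn, rfl⟩
    refine ⟨permute τ.symm n, fun h0 => hn ?_, ?_⟩
    · ext k
      simpa [permute] using congrFun h0 (τ.symm k)
    · change _ = g + t.B *ᵥ permute τ _
      congr 2
      ext k
      simp [permute]
  · rintro ⟨n, hn, rfl⟩
    refine ⟨permute τ n, fun h0 => hn ?_, rfl⟩
    ext k
    simpa [permute] using congrFun h0 (τ k)

theorem HasPrincipalPart.sum_mapDomain_lowerDegree (h : HasPrincipalPart b d τ t)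
    (g : U ⊕ F → ℤ) (β : (U → ℕ) →₀ Base) :
    ((β.mapDomain (lowerDegree t τ g)).sum fun g' a => a • pointedFamily t τ D g') =
      ser t τ g (combination b D (unfrozen F τ g) β) := by
  rw [Finsupp.sum_mapDomain_index (by simp) (by intros; rw [_root_.add_smul]), combination,
    map_finsuppSum]
  refine Finsupp.sum_congr fun n _ => ?_
  rw [map_smul, lowerDegree, h.pointedFamily_add_yExp]

theorem triangular_transfer (h : HasPrincipalPart b d τ t) (h' : HasPrincipalPart b d τ' t')
    (hD : ∀ u, D u 0 = 1)
    (htri : ∀ (i : U ⊕ F) (g : U ⊕ F → ℤ), ∃ x : (U ⊕ F → ℤ) →₀ Base,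
      (∀ g' ∈ x.support, Dominated t g' (g + f i) ∧ x g' ∈ maxIdeal) ∧
      IsNormalization t (QTorus.X t.Λ (f i) * pointedFamily t τ D g)
        (pointedFamily t τ D (g + f i) + x.sum fun g' a => a • pointedFamily t τ D g'))
    (i : U ⊕ F') (g : U ⊕ F' → ℤ) :
    ∃ x : (U ⊕ F' → ℤ) →₀ Base,
      (∀ g' ∈ x.support, Dominated t' g' (g + f i) ∧ x g' ∈ maxIdeal) ∧
      IsNormalization t' (QTorus.X t'.Λ (f i) * pointedFamily t' τ' D g)
        (pointedFamily t' τ' D (g + f i) + x.sum fun g' a => a • pointedFamily t' τ' D g') := by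
  rcases i with i | j
  · obtain ⟨k, rfl⟩ : ∃ k, i = τ' k := ⟨τ'.symm i, by simp⟩
    set u := unfrozen F' τ' g with hu
    set g₀ : U ⊕ F → ℤ := extend (permute τ u) with hg₀
    have hu₀ : unfrozen F τ g₀ = u := unfrozen_extend u
    obtain ⟨x, hx, -, α, hα⟩ := htri (Sum.inl (τ k)) g₀
    set β := Finsupp.comapDomain (lowerDegree t τ (g₀ + f (Sum.inl (τ k)))) x
      (h.lowerDegree_injective _).injOn with hβ
    have hxβ : β.mapDomain (lowerDegree t τ (g₀ + f (Sum.inl (τ k)))) = x := by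
      refine Finsupp.mapDomain_comapDomain _ (h.lowerDegree_injective _) x fun g' hg' => ?_
      obtain ⟨n, -, rfl⟩ := (dominated_iff t τ _ _).1 (hx g' hg').1
      exact ⟨n, rfl⟩
    have hβn : ∀ n ∈ β.support, n ≠ 0 ∧ β n ∈ maxIdeal := by
      intro n hn
      rw [hβ, Finsupp.mem_support_iff, Finsupp.comapDomain_apply] at hn
      obtain ⟨h1, h2⟩ := hx _ (Finsupp.mem_support_iff.2 hn)
      obtain ⟨n', hn', he⟩ := (dominated_iff t τ _ _).1 h1
      rw [h.lowerDegree_injective _ he]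
      exact ⟨hn', by rw [← h.lowerDegree_injective _ he]; exact h2⟩
    -- The triangularity relation in `LP(t)` is one between coefficient families.
    rw [← hxβ, h.sum_mapDomain_lowerDegree, pointedFamily, pointedFamily, h.X_mul_ser, ← map_add,
      map_add (unfrozen F τ), unfrozen_unit, hu₀, ← (ser t τ _).map_smul (qHalf _) (twist _ _ _),
      ← (ser t τ _).map_smul (qHalf α)] at hα
    have hα' := h.ser_injective _ hα
    have hx' : ∀ g' ∈ (β.mapDomain (lowerDegree t' τ' (g + f (Sum.inl (τ' k))))).support,
        Dominated t' g' (g + f (Sum.inl (τ' k))) ∧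
          β.mapDomain (lowerDegree t' τ' (g + f (Sum.inl (τ' k)))) g' ∈ maxIdeal := by
      intro g' hg'
      obtain ⟨n, hn, rfl⟩ := Finset.mem_image.1 (Finsupp.mapDomain_support hg')
      rw [Finsupp.mapDomain_apply (h'.lowerDegree_injective _)]
      exact ⟨(dominated_iff t' τ' _ _).2 ⟨n, (hβn n hn).1, rfl⟩, (hβn n hn).2⟩
    refine ⟨_, hx', ⟨_, (pointedFamily_isPointed hD _).add_sum (pointedFamily_isPointed hD) _
      (fun g' hg' => (hx' g' hg').1) _⟩,
      form t'.Λ (f (Sum.inl (τ' k))) g + (α - form t.Λ (f (Sum.inl (τ k))) g₀), ?_⟩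
    rw [h'.sum_mapDomain_lowerDegree, pointedFamily, pointedFamily, h'.X_mul_ser, ← map_add,
      map_add (unfrozen F' τ'), unfrozen_unit, ← hu, ← qHalf_smul_smul,
      ← (ser t' τ' _).map_smul (qHalf (α - _))]
    congr 2
    rw [← qHalf_smul_inj (a := form t.Λ (f (Sum.inl (τ k))) g₀), hα', qHalf_smul_smul,
      add_sub_cancel]
  · have hj : unfrozen F' τ' (f (Sum.inr j)) = 0 := by
      ext i
      simp [unfrozen_apply]
    refine ⟨0, by simp, ?_⟩
    rw [Finsupp.sum_zero_index, add_zero]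
    refine ⟨⟨_, pointedFamily_isPointed hD _⟩, form t'.Λ (f (Sum.inr j)) g, ?_⟩
    rw [pointedFamily, pointedFamily, h'.X_mul_ser, hj, twist_zero, map_add, hj, add_zero]

end TransferBasis

end QuantumCluster

end

open QuantumCluster in
theorem mainTheorem7 {U F F' : Type*} [Fintype U] [Fintype F] [Fintype F']
    [DecidableEq U] [DecidableEq F] [DecidableEq F']
    (t : QuantumCluster.QuantumSeed U F) (t' : QuantumCluster.QuantumSeed U F')
    (τ : Equiv.Perm U) (hsim : QuantumCluster.Similar τ t t')
    (L : (U ⊕ F → ℤ) → QuantumCluster.LP t) (hL : QuantumCluster.IsTriangularBasis t L) :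
    ∃ L' : (U ⊕ F' → ℤ) → QuantumCluster.LP t',
      QuantumCluster.IsTriangularBasis t' L' ∧
      ∀ (g : U → ℤ) (c : (U → ℕ) →₀ QuantumCluster.Base), c 0 = 1 →
        L (QuantumCluster.extend g) = QuantumCluster.fSeries t (QuantumCluster.extend g) c →
        L' (QuantumCluster.extend (QuantumCluster.permute τ g)) =
          QuantumCluster.fSeries t' (QuantumCluster.extend (QuantumCluster.permute τ g))
            (c.mapDomain (QuantumCluster.permute τ)) := by
  have h : HasPrincipalPart (fun i j => t.B (Sum.inl i) j) t.d 1 t := ⟨fun _ _ => rfl, fun _ => rfl⟩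
  have h' : HasPrincipalPart (fun i j => t.B (Sum.inl i) j) t.d τ t' :=
    ⟨fun i j => (hsim.1 i j).symm, fun k => (hsim.2 k).symm⟩
  obtain ⟨D, hD, hLD⟩ := hL.exists_coefficients h
  obtain rfl : L = pointedFamily t 1 D := funext hLD
  refine ⟨pointedFamily t' τ D,
    { linearIndependent := linearIndependent_of_isPointed (pointedFamily_isPointed hD)
      span_eq := span_pointedFamily_transfer h h' hL.span_eq
      monomial_mem := monomial_mem_pointedFamily_transfer h hD hL.monomial_mem
      shift_monomial_mem := shift_monomial_mem_transfer h h' hL.shift_monomial_mem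
      pointed := pointedFamily_isPointed hD
      bar_eq := bar_pointedFamily_transfer h hL.bar_eq
      triangular := triangular_transfer h h' hD hL.triangular }, fun g c _ hc => ?_⟩
  rw [fSeries_eq_ser, pointedFamily] at hc
  rw [fSeries_mapDomain_permute, pointedFamily_extend, ← h.ser_injective _ hc, unfrozen_one_extend]
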